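/- Let $\Omega_{\mathcal X}$ be a compact smooth Riemannian manifold without boundary, with Riemannian distance $d_{\mathcal X}$ and Riemannian volume $dx$, and let $p:\Omega_{\mathcal X}\to(0,\infty)$ be a continuous, strictly positive probability density with respect to $dx$. Let $G$ be a Lie group acting smoothly, freely, properly and by isometries on $\Omega_{\mathcal X}$, such that all orbits $G(x)$, $x\in\Omega_{\mathcal X}$, have the same Riemannian volume, and put $d=\dim(\Omega_{\mathcal X}/G)=\dim\Omega_{\mathcal X}-\dim G$; assume $d\ge 1$. Let $\mathcal Y$ be a metric space with distance $d_{\mathcal Y}$ on which $G$ acts, let $y:\Omega_{\mathcal X}\to\mathcal Y$ be the target function, let $\Omega=\{(x,y(x)) : x\in\Omega_{\mathcal X}\}$ be its graph, and let $\ell$ be the additively separable cost $$\ell\big((x,u),(x',u')\big)=d_{\mathcal X}(x,x')^2+d_{\mathcal Y}(u,u')^2 .$$ Let $L>0$. Suppose that a training procedure associates with every finite dataset $\mathbb D$ of points of $\Omega$ a model $f=f_{\mathbb D}:\Omega_{\mathcal X}\to\mathcal Y$ that is $G$-equivariant ($f(gx)=g f(x)$) and $L$-Lipschitz (with $L$ independent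 of $\mathbb D$), together with a prediction space $\Omega_f=\Omega_f(\mathbb D)\subset\Omega_{\mathcal X}\times\mathcal Y$ satisfying $$G(\mathbb D)\subseteq\Omega_f\subseteq\{(x,f(x)) : x\in\Omega_{\mathcal X}\},\qquad G(\mathbb D)=\{(gx,gu) : (x,u)\in\mathbb D,\ g\in G\}.$$ (In particular $f$ interpolates the data. The choices $\Omega_f=G(\mathbb D)$ and $\Omega_f=\operatorname{graph} f$ are both allowed.) Define the conditional representation gap $$\mathcal R(\Omega,\Omega_f)=\int_{\Omega_{\mathcal X}}\ \inf_{z'\in\Omega_f}\ \ell\big((x,y(x)),z'\big)\,p(x)\,dx .$$ (i.i.d.) Let $X_1,X_2,\dots$ be i.i.d. with law $p(x)\,dx$, let $\mathbb D_n=\{(X_i,y(X_i)) : 1\le i\le n\}$, and let $\mathcal R_n=\mathcal R(\Omega,\Omega_f(\mathbb D_n))$. Then $\mathcal R_n=O_{\mathbb P}(n^{-2/d})$: for every $\varepsilon>0$ there is a constant $C$ such that $\mathbb P(\mathcal R_n>C\,n^{-2/d})\le\varepsilon$ for all sufficiently large $n$. (optimal) Let $\mathcal R_n^\star=\inf\{\mathcal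 R(\Omega,\Omega_f(\mathbb D)) : \mathbb D\subset\Omega,\ |\mathbb D|=n\}$. Then $\mathcal R_n^\star=O(n^{-2/d})$ as $n\to\infty$. -/

import Mathlib

open Set Filter MeasureTheory ProbabilityTheory Bundle
open scoped ENNReal NNReal Topology Manifold ContDiff Bundle

noncomputable section

/-- The Riemannian volume measure of an `m`-dimensional Riemannian manifold `M`, as the
`m`-dimensional Hausdorff measure of the Riemannian distance, normalised so that it is
Lebesgue measure on Euclidean `m`-space. Applied to a `k`-dimensional submanifold, the same
measure with `m` replaced by `k` is the `k`-dimensional Riemannian volume. -/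
def riemannianVolume (M : Type*) [EMetricSpace M] [MeasurableSpace M] [BorelSpace M] (m : ℕ) :
    Measure M :=
  μHE[m]

/-- The law `p(x) dx` on `M`, where `dx` is the Riemannian volume. -/
def dataLaw {M : Type*} [EMetricSpace M] [MeasurableSpace M] [BorelSpace M] (m : ℕ)
    (p : M → ℝ) : Measure M :=
  (riemannianVolume M m).withDensity (fun x => ENNReal.ofReal (p x))

/-- The graph of a function, as a subset of the product. -/
def graphSet {M Y : Type*} (h : M → Y) : Set (M × Y) :=
  {z | z.2 = h z.1}

/-- The additively separable cost `ℓ((x, y), (x', y')) = d(x, x')² + d(y, y')²`. -/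
def separableCost {M Y : Type*} [EMetricSpace M] [EMetricSpace Y] (z z' : M × Y) : ℝ≥0∞ :=
  edist z.1 z'.1 ^ 2 + edist z.2 z'.2 ^ 2

/-- The augmented dataset `G(D) = {(g x, g y) | (x, y) ∈ D, g ∈ G}`. -/
def augmentation (G : Type*) {M Y : Type*} [Group G] [MulAction G M] [MulAction G Y] {n : ℕ}
    (D : Fin n → M × Y) : Set (M × Y) :=
  {z | ∃ (g : G) (i : Fin n), z = (g • (D i).1, g • (D i).2)}

/-- The conditional representation gap of a prediction space `S`, for inputs of law `ν` and the
target function `y`:  `∫ inf_{z' ∈ S} ℓ((x, y x), z') dν(x)`. -/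
def representationGap {M Y : Type*} [EMetricSpace M] [MeasurableSpace M] [EMetricSpace Y]
    (ν : Measure M) (y : M → Y) (S : Set (M × Y)) : ℝ≥0∞ :=
  ∫⁻ x, ⨅ z' ∈ S, separableCost (x, y x) z' ∂ν

/-- The optimal representation gap for datasets of `n` distinct points of the graph of `y`, where
`predSpace n D` is the prediction space of the model trained on `D`. -/
def optimalGap {M Y : Type*} [EMetricSpace M] [MeasurableSpace M] [EMetricSpace Y]
    (ν : Measure M) (y : M → Y) (predSpace : ∀ n : ℕ, (Fin n → M × Y) → Set (M × Y)) (n : ℕ) :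
    ℝ≥0∞ :=
  ⨅ (D : Fin n → M × Y) (_ : ∀ i, D i ∈ graphSet y) (_ : Function.Injective D),
    representationGap ν y (predSpace n D)

/-- A trained model: to each dataset `D` of points of the graph of `y` (any size, repetitions
allowed), training associates a function `f n D : M → Y` which is `G`-equivariant and
`L`-Lipschitz, with a prediction space `predSpace n D`. Predictions are single valued, so that the
prediction space consists of points of the graph of the trained function, and the model
interpolates the augmented dataset, so that the prediction space contains `G(D)`. The two extreme
cases are `predSpace n D = G(D)` and `predSpace n D = graph (f n D)`. -/
structure IsEquivariantInterpolatingModel (G : Type*) {M Y : Type*} [EMetricSpace M]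
    [EMetricSpace Y] [Group G] [MulAction G M] [MulAction G Y] (y : M → Y) (L : ℝ≥0)
    (f : ∀ n : ℕ, (Fin n → M × Y) → M → Y)
    (predSpace : ∀ n : ℕ, (Fin n → M × Y) → Set (M × Y)) : Prop where
  equivariant : ∀ (n : ℕ) (D : Fin n → M × Y), (∀ i, D i ∈ graphSet y) →
    ∀ (g : G) (x : M), f n D (g • x) = g • f n D x
  lipschitz : ∀ (n : ℕ) (D : Fin n → M × Y), (∀ i, D i ∈ graphSet y) → LipschitzWith L (f n D)
  augmentation_subset : ∀ (n : ℕ) (D : Fin n → M × Y), (∀ i, D i ∈ graphSet y) →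
    augmentation G D ⊆ predSpace n D
  subset_graph : ∀ (n : ℕ) (D : Fin n → M × Y), (∀ i, D i ∈ graphSet y) →
    predSpace n D ⊆ graphSet (f n D)

/-- `R n = O_P(a n)`: for every `ε > 0` there is a constant `C` such that
`μ(R n > C a n) ≤ ε` for all sufficiently large `n`. -/
def IsBigOInProbability {S : Type*} [MeasurableSpace S] (μ : Measure S) (R : ℕ → S → ℝ≥0∞)
    (a : ℕ → ℝ) : Prop :=
  ∀ ε : ℝ≥0∞, 0 < ε → ∃ C : ℝ, ∀ᶠ n in atTop, μ {s | ENNReal.ofReal (C * a n) < R n s} ≤ ε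

end

/-! Interpolating every dataset forces the target itself to be `L`-Lipschitz and equivariant. Points
of `G(D)` therefore lie on the graph of `y`, and the gap is at most `1 + L ^ 2` times the mean
squared distance to the orbits of the inputs (`representationGap_le`). What remains is quantization
of the orbit space, for which one geometric fact suffices: tubes of small radius `r` around orbits
have mass at least `c * r ^ d`.

That fact is a double count (`exists_le_measure_tube`). Balls have mass at least of order `r ^ (k +
d)`, by `exists_le_riemannianVolume_eball` and the positive minimum of the density. Freeness makes
orbit maps immersions, uniformly by compactness (`exists_le_edist_smul_smul`), so the group
parameters near the identity that move `x` into a given ball of radius `r` fill a volume at most of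
order `r ^ k`. The quotient is `r ^ d`.

Given the tube bound, a maximal separated family of orbits at scale `n ^ (-1/d)` has at most `n`
members and is dense at that scale, which settles the optimal case. For an i.i.d. sample, the
distance from a point to the sampled orbits exceeds a small `t` with probability at most `exp (-c n
t ^ d)`. Integrating this tail gives a mean square of order `n ^ (-2/d)`, and Markov's inequality
concludes. The distance is truncated where the tube bound stops; the truncation is inactive outside
an event of vanishing probability. -/

/-! ### Charts are locally bi-Lipschitz for the Riemannian distance. -/

section ChartComparison

attribute [local instance] normedAddCommGroupTangentSpaceVectorSpace
attribute [local instance] normedSpaceTangentSpaceVectorSpace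

variable {E : Type*} [NormedAddCommGroup E] [NormedSpace ℝ E]
  {H : Type*} [TopologicalSpace H] (I : ModelWithCorners ℝ E H)
  {M : Type*} [PseudoEMetricSpace M] [ChartedSpace H M]
  [RiemannianBundle (fun x : M => TangentSpace I x)]
  [IsManifold I 1 M] [IsContinuousRiemannianBundle E (fun x : M => TangentSpace I x)]
  [IsRiemannianManifold I M]

/-- The inverse of an extended chart is Lipschitz near the centre of the chart. -/
lemma exists_edist_le_mul_edist_extChartAt (x : M) :
    ∃ C > (0 : ℝ≥0), ∃ U ∈ 𝓝 x, ∀ y ∈ U, ∀ z ∈ U,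
      edist y z ≤ C * edist (extChartAt I x y) (extChartAt I x z) := by
  rcases eventually_enorm_mfderivWithin_symm_extChartAt_lt I x with ⟨C, C_pos, hC'⟩
  have hC : ∀ᶠ y in 𝓝[range I] (extChartAt I x x), ∀ w : E,
      ‖mfderiv[range I] (extChartAt I x).symm y w‖ₑ ≤ C * ‖w‖ₑ := by
    filter_upwards [hC'] with y hy w
    exact (ContinuousLinearMap.le_opENorm _ _).trans (mul_le_mul_left hy.le _)
  refine ⟨C, C_pos, ?_⟩
  obtain ⟨r, r_pos, hr⟩ : ∃ r > 0,
      Metric.ball (extChartAt I x x) r ∩ range I ⊆ (extChartAt I x).target ∩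
        {y | ∀ w : E, ‖mfderiv[range I] (extChartAt I x).symm y w‖ₑ ≤ C * ‖w‖ₑ} :=
    Metric.mem_nhdsWithin_iff.1 (inter_mem (extChartAt_target_mem_nhdsWithin x) hC)
  have A : (extChartAt I x) ⁻¹' (Metric.ball (extChartAt I x x) r ∩ range I) ∈ 𝓝 x := by
    apply extChartAt_preimage_mem_nhds_of_mem_nhdsWithin (by simp)
    rw [inter_comm]
    exact inter_mem_nhdsWithin _ (Metric.ball_mem_nhds _ r_pos)
  refine ⟨_, inter_mem A (chart_source_mem_nhds H x), ?_⟩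
  rintro y ⟨hy, h'y⟩ z ⟨hz, h'z⟩
  -- The straight segment in the chart lifts to a path in `M`, whose length bounds `edist y z`.
  let η := ContinuousAffineMap.lineMap (R := ℝ) (extChartAt I x y) (extChartAt I x z)
  set γ := (extChartAt I x).symm ∘ η
  have hη : Icc 0 1 ⊆ ⇑η ⁻¹' ((extChartAt I x).target ∩
        {y | ∀ w : E, ‖mfderiv[range I] (extChartAt I x).symm y w‖ₑ ≤ C * ‖w‖ₑ}) := by
    simp only [← image_subset_iff, ContinuousAffineMap.coe_lineMap_eq,
     ← segment_eq_image_lineMap, η]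
    apply Subset.trans _ hr
    exact ((convex_ball _ _).inter I.convex_range).segment_subset hy hz
  simp only [preimage_inter, subset_inter_iff] at hη
  have η_smooth : CMDiff[Icc 0 1] 1 η := by
    apply ContMDiff.contMDiffOn
    rw [contMDiff_iff_contDiff]
    exact ContinuousAffineMap.contDiff _
  have : edist y z ≤ Manifold.pathELength I γ 0 1 := by
    rw [IsRiemannianManifold.out (I := I) y z]
    apply Manifold.riemannianEDist_le_pathELength _ _ _ zero_le_one
    · exact (contMDiffOn_extChartAt_symm x).comp η_smooth hη.1
    · simp [γ, η, ContinuousAffineMap.coe_lineMap_eq, h'y]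
    · simp [γ, η, ContinuousAffineMap.coe_lineMap_eq, h'z]
  apply this.trans
  rw [← lintegral_fderiv_lineMap_eq_edist, Manifold.pathELength_eq_lintegral_mfderivWithin_Icc,
    ← lintegral_const_mul' _ _ ENNReal.coe_ne_top]
  apply setLIntegral_mono' measurableSet_Icc (fun t ht ↦ ?_)
  have : mfderiv[Icc 0 1] γ t =
      (mfderiv[range I] (extChartAt I x).symm (η t)) ∘L (mfderiv[Icc 0 1] η t) := by
    apply mfderivWithin_comp
    · exact mdifferentiableWithinAt_extChartAt_symm (hη.1 ht)
    · exact η_smooth.mdifferentiableOn one_ne_zero t ht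
    · exact hη.1.trans (preimage_mono (extChartAt_target_subset_range x))
    · rw [uniqueMDiffWithinAt_iff_uniqueDiffWithinAt]
      exact uniqueDiffOn_Icc zero_lt_one t ht
  have : mfderiv[Icc 0 1] γ t 1 =
      (mfderiv[range I] (extChartAt I x).symm (η t)) (mfderiv[Icc 0 1] η t 1) := congr($this 1)
  rw [this]
  refine (hη.2 ht _).trans ?_
  rw [mfderivWithin_eq_fderivWithin]
  exact le_rfl

/-- An extended chart is Lipschitz near its centre. -/
lemma exists_edist_extChartAt_le_mul_edist (x : M) :
    ∃ C > (0 : ℝ≥0), ∃ U ∈ 𝓝 x, ∀ y ∈ U, ∀ z ∈ U,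
      edist (extChartAt I x y) (extChartAt I x z) ≤ C * edist y z := by
  rcases eventually_enorm_mfderiv_extChartAt_lt I x with ⟨C, C_pos, hC⟩
  obtain ⟨r, r_pos, hr⟩ := EMetric.mem_nhds_iff.1
    (inter_mem hC (chart_source_mem_nhds H x))
  -- Points of the `r / 4`-ball are less than `r / 2` apart, so a path between them of length below
  -- `r / 2` stays in the `r`-ball, where the derivative bound holds.
  have h3 : 0 < r / 4 := ENNReal.div_pos r_pos.ne' (by simp)
  refine ⟨C, C_pos, _, Metric.eball_mem_nhds x h3, ?_⟩
  intro y hy z hz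
  have hyz : edist y z < r / 2 := by
    have h4 : r / 4 + r / 4 = r / 2 := by
      rw [← ENNReal.add_div, ← two_mul, show (4 : ℝ≥0∞) = 2 * 2 by norm_num,
        ENNReal.mul_div_mul_left _ _ (by simp) (by simp)]
    calc edist y z ≤ edist y x + edist z x := edist_triangle_right _ _ _
      _ < r / 4 + r / 4 := ENNReal.add_lt_add hy hz
      _ = r / 2 := h4
  by_contra! hlt
  have hlt' : Manifold.riemannianEDist I y z <
      min (edist (extChartAt I x y) (extChartAt I x z) / C) (r / 2) := by
    rw [← IsRiemannianManifold.out (I := I) y z, lt_min_iff]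
    refine ⟨?_, hyz⟩
    rw [ENNReal.lt_div_iff_mul_lt (by simp [C_pos.ne']) (by simp), mul_comm]
    exact hlt
  rcases Manifold.exists_lt_locally_constant_of_riemannianEDist_lt hlt' zero_lt_one
    with ⟨γ, hγy, hγz, γ_smooth, hγ, -⟩
  rw [lt_min_iff] at hγ
  have hmem : ∀ t ∈ Icc (0 : ℝ) 1, γ t ∈ Metric.eball x r := by
    intro t ht
    have h1 : edist y (γ t) < r / 2 := by
      rw [IsRiemannianManifold.out (I := I) y (γ t)]
      refine lt_of_le_of_lt ?_ hγ.2
      refine (Manifold.riemannianEDist_le_pathELength γ_smooth.contMDiffOn hγy rfl ht.1).trans ?_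
      exact Manifold.pathELength_mono le_rfl ht.2
    have h2 : edist y x < r / 2 :=
      lt_of_lt_of_le hy (ENNReal.div_le_div_left (by norm_num) _)
    calc edist (γ t) x ≤ edist y (γ t) + edist y x := edist_triangle_left _ _ _
      _ < r / 2 + r / 2 := ENNReal.add_lt_add h1 h2
      _ = r := ENNReal.add_halves r
  let γ' := extChartAt I x ∘ γ
  have hsm : CMDiff[Icc 0 1] 1 γ' :=
    contMDiffOn_extChartAt.comp (I' := I) (t := (chartAt H x).source)
      γ_smooth.contMDiffOn (fun t ht ↦ (hr (hmem t ht)).2)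
  refine lt_irrefl (edist (extChartAt I x y) (extChartAt I x z)) ?_
  calc edist (extChartAt I x y) (extChartAt I x z)
    _ = ‖γ' 1 - γ' 0‖ₑ := by
      rw [edist_comm, edist_eq_enorm_sub]; simp [γ', hγy, hγz]
    _ ≤ ∫⁻ t in Icc 0 1, ‖derivWithin γ' (Icc 0 1) t‖ₑ := by
      apply enorm_sub_le_lintegral_derivWithin_Icc_of_contDiffOn_Icc _ zero_le_one
      rwa [← contMDiffOn_iff_contDiffOn]
    _ = ∫⁻ t in Icc 0 1, ‖mfderiv[Icc 0 1] γ' t 1‖ₑ := by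
      simp_rw [← fderivWithin_derivWithin, mfderivWithin_eq_fderivWithin]
      rfl
    _ ≤ ∫⁻ t in Icc 0 1, C * ‖mfderiv[Icc 0 1] γ t 1‖ₑ := by
      apply setLIntegral_mono' measurableSet_Icc (fun t ht ↦ ?_)
      have : mfderiv[Icc 0 1] γ' t =
          (mfderiv% (extChartAt I x) (γ t)) ∘L (mfderiv[Icc 0 1] γ t) := by
        apply mfderiv_comp_mfderivWithin
        · exact mdifferentiableAt_extChartAt (hr (hmem t ht)).2
        · exact (γ_smooth.mdifferentiable one_ne_zero).mdifferentiableOn _ ht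
        · rw [uniqueMDiffWithinAt_iff_uniqueDiffWithinAt]
          exact uniqueDiffOn_Icc zero_lt_one _ ht
      have : mfderiv[Icc 0 1] γ' t 1 =
          (mfderiv% (extChartAt I x) (γ t)) (mfderiv[Icc 0 1] γ t 1) :=
        congr($this 1)
      rw [this]
      apply (ContinuousLinearMap.le_opENorm _ _).trans
      gcongr
      exact (hr (hmem t ht)).1.le
    _ = C * Manifold.pathELength I γ 0 1 := by
      rw [lintegral_const_mul' _ _ ENNReal.coe_ne_top,
          Manifold.pathELength_eq_lintegral_mfderivWithin_Icc]
    _ < C * (edist (extChartAt I x y) (extChartAt I x z) / C) :=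
      ENNReal.mul_lt_mul_right (by simp [C_pos.ne']) (by simp) hγ.1
    _ = _ := ENNReal.mul_div_cancel (by simp [C_pos.ne']) (by simp)
end ChartComparison

/-! ### Lower bound on the volume of small balls. -/

section BallVolume

/-- A `K`-Lipschitz map increases the Euclidean Hausdorff measure by at most the factor `K ^ m`. -/
lemma LipschitzOnWith.euclideanHausdorffMeasure_image_le {X Z : Type*}
    [EMetricSpace X] [MeasurableSpace X] [BorelSpace X]
    [EMetricSpace Z] [MeasurableSpace Z] [BorelSpace Z]
    {K : ℝ≥0} {h : X → Z} {s : Set X} (hh : LipschitzOnWith K h s) (m : ℕ) :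
    (μHE[m] : Measure Z) (h '' s) ≤ (K : ℝ≥0∞) ^ m * (μHE[m] : Measure X) s := by
  have h1 := hh.hausdorffMeasure_image_le (d := m) (by positivity)
  rw [Measure.euclideanHausdorffMeasure_def, Measure.euclideanHausdorffMeasure_def,
    Measure.smul_apply, Measure.smul_apply, ENNReal.smul_def, ENNReal.smul_def, smul_eq_mul,
    smul_eq_mul, mul_left_comm]
  rw [ENNReal.rpow_natCast] at h1
  gcongr

variable {m : ℕ} {M : Type*} [EMetricSpace M]
    [ChartedSpace (EuclideanSpace ℝ (Fin m)) M] [IsManifold (𝓡 m) 1 M]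
    [RiemannianBundle (fun x : M => TangentSpace (𝓡 m) x)]
    [IsContinuousRiemannianBundle (EuclideanSpace ℝ (Fin m))
      (fun x : M => TangentSpace (𝓡 m) x)]
    [IsRiemannianManifold (𝓡 m) M]

/-- Small balls of a Riemannian manifold contain the preimages of comparable balls in charts. -/
lemma exists_ball_subset_image_extChartAt (x₀ : M) :
    ∃ C > (0 : ℝ≥0), ∃ r₀ > (0 : ℝ), ∀ᶠ x in 𝓝 x₀, ∀ r : ℝ, 0 < r → r ≤ r₀ →
      ∃ s ⊆ Metric.eball x (ENNReal.ofReal r), LipschitzOnWith C (extChartAt (𝓡 m) x₀) s ∧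
        Metric.ball (extChartAt (𝓡 m) x₀ x) (r / C) ⊆ extChartAt (𝓡 m) x₀ '' s := by
  obtain ⟨C₁, hC₁, U₁, hU₁, h₁⟩ := exists_edist_le_mul_edist_extChartAt (𝓡 m) x₀
  obtain ⟨C₂, hC₂, U₂, hU₂, h₂⟩ := exists_edist_extChartAt_le_mul_edist (𝓡 m) x₀
  set ψ := extChartAt (𝓡 m) x₀
  have hpre : ψ.target ∩ ψ.symm ⁻¹' (U₁ ∩ U₂) ∈ 𝓝 (ψ x₀) :=
    inter_mem (extChartAt_target_mem_nhds x₀) (extChartAt_preimage_mem_nhds (inter_mem hU₁ hU₂))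
  obtain ⟨ρ, hρ, hball⟩ := Metric.mem_nhds_iff.1 hpre
  have hev : ∀ᶠ x in 𝓝 x₀, ψ x ∈ Metric.ball (ψ x₀) (ρ / 2) :=
    (continuousAt_extChartAt x₀) (Metric.ball_mem_nhds _ (by positivity))
  set C := max C₁ C₂
  have hC : 0 < C := lt_max_of_lt_left hC₁
  have hC' : (0 : ℝ) < C := hC
  -- For `r` up to this radius, the chart ball of radius `r / C` about `ψ x` stays in the `ρ`-ball
  -- about `ψ x₀`.
  refine ⟨C, hC, ρ / 2 * C, by positivity, ?_⟩
  filter_upwards [hev, hU₁, extChartAt_source_mem_nhds (I := 𝓡 m) x₀] with x hx hxU hxs r hr hr₀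
  have hsub : Metric.ball (ψ x) (r / C) ⊆ ψ.target ∩ ψ.symm ⁻¹' (U₁ ∩ U₂) := by
    refine Subset.trans (Metric.ball_subset_ball' ?_) hball
    have : r / C ≤ ρ / 2 := by rwa [div_le_iff₀ hC']
    have := (Metric.mem_ball.1 hx).le
    linarith
  refine ⟨ψ.symm '' Metric.ball (ψ x) (r / C), ?_, ?_, ?_⟩
  · rintro _ ⟨u, hu, rfl⟩
    have h3 := h₁ (ψ.symm u) (hsub hu).2.1 x hxU
    rw [Metric.mem_eball]
    refine h3.trans_lt ?_
    rw [ψ.right_inv (hsub hu).1, edist_dist, ← ENNReal.ofReal_coe_nnreal,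
      ← ENNReal.ofReal_mul (by positivity)]
    refine (ENNReal.ofReal_lt_ofReal_iff hr).2 ?_
    have h4 := Metric.mem_ball.1 hu
    rw [lt_div_iff₀ hC'] at h4
    have h5 : (C₁ : ℝ) ≤ C := le_max_left C₁ C₂
    nlinarith [dist_nonneg (x := u) (y := ψ x)]
  · rintro _ ⟨u, hu, rfl⟩ _ ⟨v, hv, rfl⟩
    refine (h₂ _ (hsub hu).2.2 _ (hsub hv).2.2).trans ?_
    gcongr
    exact le_max_right C₁ C₂
  · intro u hu
    exact ⟨ψ.symm u, ⟨u, hu, rfl⟩, ψ.right_inv (hsub hu).1⟩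

/-- In a compact Riemannian manifold of dimension `m`, small balls of radius `r` have volume at
least `c r ^ m`, uniformly. -/
theorem exists_le_riemannianVolume_eball [CompactSpace M] [MeasurableSpace M] [BorelSpace M] :
    ∃ c > (0 : ℝ), ∃ r₀ > (0 : ℝ), ∀ x : M, ∀ r : ℝ, 0 < r → r ≤ r₀ →
      ENNReal.ofReal (c * r ^ m) ≤ riemannianVolume M m (Metric.eball x (ENNReal.ofReal r)) := by
  suffices H : ∃ c > (0 : ℝ), ∃ r₀ > (0 : ℝ), ∀ x ∈ (univ : Set M), ∀ r : ℝ, 0 < r → r ≤ r₀ →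
      ENNReal.ofReal (c * r ^ m) ≤ riemannianVolume M m (Metric.eball x (ENNReal.ofReal r)) by
    simpa using H
  refine isCompact_univ.induction_on (p := fun s : Set M => ∃ c > (0 : ℝ), ∃ r₀ > (0 : ℝ),
      ∀ x ∈ s, ∀ r : ℝ, 0 < r → r ≤ r₀ →
      ENNReal.ofReal (c * r ^ m) ≤ riemannianVolume M m (Metric.eball x (ENNReal.ofReal r)))
    ⟨1, one_pos, 1, one_pos, by simp⟩ ?_ ?_ ?_
  · rintro s t hst ⟨c, hc, r₀, hr₀, h⟩
    exact ⟨c, hc, r₀, hr₀, fun x hx => h x (hst hx)⟩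
  · rintro s t ⟨c, hc, r₀, hr₀, h⟩ ⟨c', hc', r₀', hr₀', h'⟩
    refine ⟨min c c', lt_min hc hc', min r₀ r₀', lt_min hr₀ hr₀', ?_⟩
    rintro x (hx | hx) r hr hrr
    · refine le_trans ?_ (h x hx r hr (hrr.trans (min_le_left _ _)))
      gcongr
      exact min_le_left _ _
    · refine le_trans ?_ (h' x hx r hr (hrr.trans (min_le_right _ _)))
      gcongr
      exact min_le_right _ _
  · intro x₀ _
    obtain ⟨C, hC, r₀, hr₀, h⟩ := exists_ball_subset_image_extChartAt (m := m) x₀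
    have hC' : (0 : ℝ) < C := hC
    set τ := volume (Metric.ball (0 : EuclideanSpace ℝ (Fin m)) 1)
    have hτ : 0 < τ.toReal := ENNReal.toReal_pos
      (Metric.measure_ball_pos _ _ one_pos).ne' measure_ball_lt_top.ne
    -- One factor `C ^ m` comes from the chart radius `r / C`, the other from the Lipschitz constant
    -- of the chart.
    refine ⟨_, mem_nhdsWithin_of_mem_nhds h, τ.toReal / (C ^ (2 * m) : ℝ), by positivity,
      r₀, hr₀, ?_⟩
    intro x hx r hr hrr
    obtain ⟨s, hs, hlip, hsub⟩ := hx r hr hrr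
    have h1 := hlip.euclideanHausdorffMeasure_image_le m
    rw [EuclideanSpace.euclideanHausdorffMeasure_eq_volume] at h1
    have h2 := (measure_mono hsub).trans h1
    rw [Measure.addHaar_ball_of_pos _ _ (by positivity), finrank_euclideanSpace_fin] at h2
    have h3 : ENNReal.ofReal (τ.toReal / (C ^ (2 * m) : ℝ) * r ^ m) * (C : ℝ≥0∞) ^ m =
        ENNReal.ofReal ((r / C) ^ m) * τ := by
      rw [← ENNReal.ofReal_toReal (a := τ) measure_ball_lt_top.ne, ← ENNReal.ofReal_coe_nnreal,
        ← ENNReal.ofReal_pow (by positivity), ← ENNReal.ofReal_mul (by positivity),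
        ← ENNReal.ofReal_mul (by positivity), ENNReal.toReal_ofReal (by positivity)]
      congr 1
      rw [div_pow]
      field_simp
      ring
    rw [← h3, mul_comm] at h2
    refine le_trans ?_ (measure_mono hs)
    exact (ENNReal.mul_le_mul_iff_right (pow_ne_zero _ (by simpa using hC.ne')) (by simp)).1 h2

end BallVolume

/-! ### Free actions are infinitesimally free. -/

section InfinitesimalFreeness

variable {k m : ℕ} {M : Type*} [TopologicalSpace M]
    [ChartedSpace (EuclideanSpace ℝ (Fin m)) M] [IsManifold (𝓡 m) ∞ M]
    {G : Type*} [TopologicalSpace G] [ChartedSpace (EuclideanSpace ℝ (Fin k)) G] [Group G]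
    [LieGroup (𝓡 k) ∞ G] [MulAction G M]
    [ContMDiffSMul (𝓡 k) (𝓡 m) ∞ G M]

/-- The orbit maps of a free smooth action of a Lie group are immersions at the identity. -/
theorem eq_zero_of_mfderiv_orbit_eq_zero {x : M} (hfree : ∀ g : G, g • x = x → g = 1)
    (v : TangentSpace (𝓡 k) (1 : G))
    (hv : mfderiv (𝓡 k) (𝓡 m) (fun g : G => g • x) 1 v = 0) : v = 0 := by
  have : LieGroup (𝓡 k) (minSmoothness ℝ 3) G := by
    rw [minSmoothness_of_isRCLikeNormedField]
    exact LieGroup.of_le (n := ∞) (by norm_cast)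
  have : IsManifold (𝓡 k) 1 G := IsManifold.of_le (n := ∞) (by norm_cast)
  have : IsManifold (𝓡 m) 1 M := IsManifold.of_le (n := ∞) (by norm_cast)
  have horb : ContMDiff (𝓡 k) (𝓡 m) ∞ (fun g : G => g • x) :=
    (contMDiff_smul (I := 𝓡 k) (I' := 𝓡 m) (n := ∞)).comp (contMDiff_id.prodMk contMDiff_const)
  have hact : ∀ g : G, ContMDiff (𝓡 m) (𝓡 m) ∞ (fun z : M => g • z) := fun g =>
    (contMDiff_smul (I := 𝓡 k) (I' := 𝓡 m) (n := ∞)).comp (contMDiff_const.prodMk contMDiff_id)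
  -- Take an integral curve of the left-invariant field of `v`. The orbit map kills this field
  -- everywhere, so `γ t • x` is constant near `0`; freeness makes `γ` constant there, and `v = γ' 0
  -- = 0`.
  obtain ⟨γ, hγ0, hγ⟩ := exists_isMIntegralCurveAt_of_contMDiffAt_boundaryless (I := 𝓡 k) (0 : ℝ)
    (x₀ := (1 : G)) (v := fun g => mulInvariantVectorField v g)
    ((contMDiffAt_mulInvariantVectorField v).of_le
      (by rw [minSmoothness_of_isRCLikeNormedField]; norm_num))
  have hzero : ∀ g : G, mfderiv (𝓡 k) (𝓡 m) (fun g : G => g • x) g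
      (mulInvariantVectorField v g) = 0 := by
    intro g
    have hmul : MDifferentiableAt (𝓡 k) (𝓡 k) (fun h : G => g * h) 1 :=
      (contMDiff_mul_left (I := 𝓡 k) (n := ∞)).contMDiffAt.mdifferentiableAt (by simp)
    have e1 := mfderiv_comp_apply (I := 𝓡 k) (I' := 𝓡 k) (I'' := 𝓡 m) (1 : G)
      (g := fun g : G => g • x) (f := fun h : G => g * h)
      (horb.contMDiffAt.mdifferentiableAt (by simp)) hmul v
    have e2 := mfderiv_comp_apply (I := 𝓡 k) (I' := 𝓡 m) (I'' := 𝓡 m) (1 : G)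
      (g := fun z : M => g • z) (f := fun h : G => h • x)
      ((hact g).contMDiffAt.mdifferentiableAt (by simp))
      (horb.contMDiffAt.mdifferentiableAt (by simp)) v
    have e3 : (fun g : G => g • x) ∘ (fun h : G => g * h) =
        (fun z : M => g • z) ∘ (fun h : G => h • x) := by
      ext h; simp [mul_smul]
    rw [hv, map_zero] at e2
    rw [e3] at e1
    have e4 := e1.symm.trans e2
    -- The chain rule gives the derivative at `g * 1`; generalizing the base point transports it to
    -- `g`.
    have e5 : ∀ g' : G, g' = g → (mfderiv (𝓡 k) (𝓡 m) (fun g : G => g • x) g' :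
        EuclideanSpace ℝ (Fin k) →L[ℝ] EuclideanSpace ℝ (Fin m))
        (mfderiv (𝓡 k) (𝓡 k) (fun h : G => g * h) 1 v) = 0 →
        mfderiv (𝓡 k) (𝓡 m) (fun g : G => g • x) g (mulInvariantVectorField v g) = 0 := by
      rintro _ rfl h
      exact h
    exact e5 _ (mul_one g) e4
  have h1 : IsMIntegralCurveAt (I := 𝓡 m) (fun t => γ t • x) (fun _ => 0) 0 := by
    filter_upwards [hγ] with t ht
    have := (horb.contMDiffAt.mdifferentiableAt (by simp) (x := γ t)).hasMFDerivAt.comp t ht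
    have e : (mfderiv (𝓡 k) (𝓡 m) (fun g : G => g • x) (γ t)).comp
        ((1 : ℝ →L[ℝ] ℝ).smulRight (mulInvariantVectorField v (γ t))) =
        (1 : ℝ →L[ℝ] ℝ).smulRight 0 := by
      refine ContinuousLinearMap.ext fun a => ?_
      rw [ContinuousLinearMap.comp_apply, ContinuousLinearMap.smulRight_apply, map_smul, hzero]
      rfl
    exact this.congr_mfderiv e
  have h2 : IsMIntegralCurveAt (I := 𝓡 m) (fun _ : ℝ => x) (fun _ => 0) 0 := by
    refine Eventually.of_forall fun t => ?_
    have e : (1 : ℝ →L[ℝ] ℝ).smulRight (0 : TangentSpace (𝓡 m) x) = 0 := by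
      refine ContinuousLinearMap.ext fun a => ?_
      rw [ContinuousLinearMap.smulRight_apply, smul_zero]
      rfl
    exact (hasMFDerivAt_const x t).congr_mfderiv e.symm
  have h3 := isMIntegralCurveAt_eventuallyEq_of_contMDiffAt_boundaryless (I := 𝓡 m)
    (contMDiff_zeroSection ℝ (TangentSpace (𝓡 m) (M := M))).contMDiffAt
     h1 h2 (by simp [hγ0])
  have h4 : γ =ᶠ[𝓝 0] fun _ => 1 := h3.mono fun t ht => hfree _ ht
  have h5 := hγ.hasMFDerivAt
  have h6 := h5.congr_of_eventuallyEq h4.symm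
  have h7 := hasMFDerivAt_unique h6 (hasMFDerivAt_const _ _)
  have h8 : ((1 : ℝ →L[ℝ] ℝ) 1) • (mulInvariantVectorField v (γ 0)) = 0 :=
    congrArg (fun A : ℝ →L[ℝ] EuclideanSpace ℝ (Fin k) => A 1) h7
  rw [one_apply_eq_self, one_smul, hγ0, mulInvariantVectorField] at h8
  have h9 := (hasMFDerivAt_id (I := 𝓡 k) (1 : G)).congr_of_eventuallyEq
    (f₁ := fun h : G => 1 * h) (Eventually.of_forall fun h => one_mul h)
  rw [h9.mfderiv] at h8
  exact h8

end InfinitesimalFreeness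

/-! ### Uniform lower bounds for orbit maps. -/

section UniformImmersion

variable {k m : ℕ} {M : Type*} [EMetricSpace M]
    [ChartedSpace (EuclideanSpace ℝ (Fin m)) M] [IsManifold (𝓡 m) ∞ M]
    {G : Type*} [TopologicalSpace G] [ChartedSpace (EuclideanSpace ℝ (Fin k)) G] [Group G]
    [LieGroup (𝓡 k) ∞ G] [MulAction G M] [ContMDiffSMul (𝓡 k) (𝓡 m) ∞ G M]

/-- A smooth action read in the charts at `1` and `x₁`. -/
noncomputable def chartAction (k m : ℕ) {M : Type*} [TopologicalSpace M]
    [ChartedSpace (EuclideanSpace ℝ (Fin m)) M] (G : Type*) [TopologicalSpace G]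
    [ChartedSpace (EuclideanSpace ℝ (Fin k)) G] [Group G] [MulAction G M] (x₁ : M)
    (q : EuclideanSpace ℝ (Fin k) × EuclideanSpace ℝ (Fin m)) : EuclideanSpace ℝ (Fin m) :=
  extChartAt (𝓡 m) x₁
    ((extChartAt (𝓡 k) (1 : G)).symm q.1 • (extChartAt (𝓡 m) x₁).symm q.2)

lemma contDiffAt_chartAction (x₁ : M) :
    ContDiffAt ℝ 1 (chartAction k m G x₁) (extChartAt (𝓡 k) (1 : G) 1, extChartAt (𝓡 m) x₁ x₁) := by
  rw [← contMDiffAt_iff_contDiffAt]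
  have : IsManifold (𝓡 k) 1 G := IsManifold.of_le (n := ∞) (by norm_cast)
  have : IsManifold (𝓡 m) 1 M := IsManifold.of_le (n := ∞) (by norm_cast)
  set a : EuclideanSpace ℝ (Fin k) × EuclideanSpace ℝ (Fin m) :=
    (extChartAt (𝓡 k) (1 : G) 1, extChartAt (𝓡 m) x₁ x₁)
  have h1 : ContMDiffAt 𝓘(ℝ, EuclideanSpace ℝ (Fin k) × EuclideanSpace ℝ (Fin m)) (𝓡 k) 1
      (fun q => (extChartAt (𝓡 k) (1 : G)).symm q.1) a :=
    ContMDiffAt.comp a (I' := 𝓡 k) (g := (extChartAt (𝓡 k) (1 : G)).symm) (f := Prod.fst)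
      ((contMDiffOn_extChartAt_symm (I := 𝓡 k) (1 : G)).contMDiffAt
        (by exact extChartAt_target_mem_nhds (I := 𝓡 k) (1 : G)))
      contDiff_fst.contMDiff.contMDiffAt
  have h2 : ContMDiffAt 𝓘(ℝ, EuclideanSpace ℝ (Fin k) × EuclideanSpace ℝ (Fin m)) (𝓡 m) 1
      (fun q => (extChartAt (𝓡 m) x₁).symm q.2) a :=
    ContMDiffAt.comp a (I' := 𝓡 m) (g := (extChartAt (𝓡 m) x₁).symm) (f := Prod.snd)
      ((contMDiffOn_extChartAt_symm (I := 𝓡 m) x₁).contMDiffAt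
        (by exact extChartAt_target_mem_nhds (I := 𝓡 m) x₁))
      contDiff_snd.contMDiff.contMDiffAt
  have h3 : ContMDiffAt 𝓘(ℝ, EuclideanSpace ℝ (Fin k) × EuclideanSpace ℝ (Fin m)) (𝓡 m) 1
      (fun q => (extChartAt (𝓡 k) (1 : G)).symm q.1 • (extChartAt (𝓡 m) x₁).symm q.2) a :=
    ContMDiffAt.comp a (g := fun p : G × M => p.1 • p.2)
      ((contMDiff_smul (I := 𝓡 k) (I' := 𝓡 m) (n := ∞)).of_le (by norm_cast)).contMDiffAt
      (h1.prodMk h2)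
  refine ContMDiffAt.comp (I' := 𝓡 m) a ?_ h3
  refine contMDiffAt_extChartAt' ?_
  simp [a]

/-- Along the group directions this derivative is the coordinate form of the differential of the
orbit map. The base point is kept as `(1 : G) • x₀` because that is where `mfderiv` takes its target
chart. -/
lemma injective_fderiv_chartAction (hfree : ∀ (g : G) (x : M), g • x = x → g = 1) (x₀ : M) :
    ∀ v, fderiv ℝ (chartAction k m G ((1 : G) • x₀))
      (extChartAt (𝓡 k) (1 : G) 1, extChartAt (𝓡 m) ((1 : G) • x₀) ((1 : G) • x₀)) (v, 0) = 0 →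
      v = 0 := by
  intro v hv
  refine eq_zero_of_mfderiv_orbit_eq_zero (k := k) (m := m) (G := G) (M := M) (x := x₀)
    (fun g hg => hfree g _ hg) v ?_
  have horb : ContMDiff (𝓡 k) (𝓡 m) ∞ (fun g : G => g • x₀) :=
    (contMDiff_smul (I := 𝓡 k) (I' := 𝓡 m) (n := ∞)).comp (contMDiff_id.prodMk contMDiff_const)
  rw [(horb.contMDiffAt.mdifferentiableAt (by simp)).mfderiv]
  simp only [modelWithCornersSelf_coe, range_id, fderivWithin_univ]
  have h1 := (contDiffAt_chartAction (k := k) (m := m) (G := G) ((1 : G) • x₀)).differentiableAt (by simp)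
    |>.hasFDerivAt
  have h2 : HasFDerivAt (fun u : EuclideanSpace ℝ (Fin k) =>
      (u, extChartAt (𝓡 m) ((1 : G) • x₀) ((1 : G) • x₀)))
      (ContinuousLinearMap.inl ℝ _ _) (extChartAt (𝓡 k) (1 : G) 1) :=
    hasFDerivAt_prodMk_left _ _
  have h3 := h1.comp (extChartAt (𝓡 k) (1 : G) 1) h2
  have h4 : chartAction k m G ((1 : G) • x₀) ∘ (fun u : EuclideanSpace ℝ (Fin k) =>
      (u, extChartAt (𝓡 m) ((1 : G) • x₀) ((1 : G) • x₀))) =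
      writtenInExtChartAt (𝓡 k) (𝓡 m) (1 : G) (fun g : G => g • x₀) := by
    ext1 u
    simp only [chartAction, writtenInExtChartAt, Function.comp_apply, extChartAt_to_inv]
    rw [one_smul]
  rw [h4] at h3
  rw [h3.fderiv]
  exact hv

/-- Strict differentiability in the group and space variables jointly makes the immersion bound
survive small changes of the base point. -/
lemma exists_nhds_le_edist_smul_smul
    {k m : ℕ} {M : Type*} [EMetricSpace M]
    [ChartedSpace (EuclideanSpace ℝ (Fin m)) M] [IsManifold (𝓡 m) ∞ M]
    [RiemannianBundle (fun x : M => TangentSpace (𝓡 m) x)]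
    [IsContinuousRiemannianBundle (EuclideanSpace ℝ (Fin m))
      (fun x : M => TangentSpace (𝓡 m) x)]
    [IsRiemannianManifold (𝓡 m) M]
    {G : Type*} [TopologicalSpace G] [ChartedSpace (EuclideanSpace ℝ (Fin k)) G] [Group G]
    [LieGroup (𝓡 k) ∞ G] [MulAction G M] [ContMDiffSMul (𝓡 k) (𝓡 m) ∞ G M]
    (hfree : ∀ (g : G) (x : M), g • x = x → g = 1) (x₀ : M) :
    ∃ V ∈ 𝓝 x₀, ∃ c > (0 : ℝ), ∃ δ > (0 : ℝ), ∀ x ∈ V,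
      ∀ u ∈ Metric.ball (extChartAt (𝓡 k) (1 : G) 1) δ,
      ∀ v ∈ Metric.ball (extChartAt (𝓡 k) (1 : G) 1) δ,
        ENNReal.ofReal (c * dist u v) ≤ edist ((extChartAt (𝓡 k) (1 : G)).symm u • x)
          ((extChartAt (𝓡 k) (1 : G)).symm v • x) := by
  have : IsManifold (𝓡 m) 1 M := IsManifold.of_le (n := ∞) (by norm_cast)
  have hcs : ContinuousSMul G M := ContMDiffSMul.continuousSMul (I := 𝓡 k) (I' := 𝓡 m) ∞
  have hinj := injective_fderiv_chartAction (k := k) (m := m) hfree x₀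
  obtain ⟨x₁, hx₁⟩ : ∃ x₁, x₁ = (1 : G) • x₀ := ⟨_, rfl⟩
  rw [← hx₁] at hinj
  rw [one_smul] at hx₁
  subst hx₁
  obtain ⟨C, hC, U, hU, hlip⟩ := exists_edist_extChartAt_le_mul_edist (𝓡 m) x₁
  have hC' : (0 : ℝ) < C := hC
  set φ := extChartAt (𝓡 k) (1 : G)
  set ψ := extChartAt (𝓡 m) x₁
  set F := chartAction k m G x₁
  have hF : HasStrictFDerivAt F (fderiv ℝ F (φ 1, ψ x₁)) (φ 1, ψ x₁) :=
    (contDiffAt_chartAction x₁).hasStrictFDerivAt (by simp)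
  set A := fderiv ℝ F (φ 1, ψ x₁)
  obtain ⟨K, hK, hanti⟩ := LinearMap.exists_antilipschitzWith
    (A.comp (ContinuousLinearMap.inl ℝ _ _)).toLinearMap
    (LinearMap.ker_eq_bot'.2 fun v hv => hinj v hv)
  have hK' : (0 : ℝ) < K := hK
  have hlow : ∀ v, (K : ℝ)⁻¹ * ‖v‖ ≤ ‖A (v, 0)‖ := by
    intro v
    have := hanti.le_mul_dist v 0
    rw [inv_mul_le_iff₀ hK']
    rw [map_zero, dist_zero_right, dist_zero_right] at this
    exact this
  have hsmul : ∀ᶠ q in 𝓝 (φ 1, ψ x₁), φ.symm q.1 • ψ.symm q.2 ∈ U := by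
    have h1 : ContinuousAt (fun q : EuclideanSpace ℝ (Fin k) × EuclideanSpace ℝ (Fin m) =>
        φ.symm q.1 • ψ.symm q.2) (φ 1, ψ x₁) :=
      (ContinuousAt.comp (f := Prod.fst) (x := (φ 1, ψ x₁))
        (continuousAt_extChartAt_symm (I := 𝓡 k) (1 : G)) continuousAt_fst).smul
        (ContinuousAt.comp (f := Prod.snd) (x := (φ 1, ψ x₁))
          (continuousAt_extChartAt_symm (I := 𝓡 m) x₁) continuousAt_snd)
    refine h1 ?_
    simpa [φ, ψ] using hU
  -- The linear part expands by at least `K⁻¹`; an error of half that size leaves `K⁻¹ / 2`.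
  have hstrict := hF.isLittleO.def (c := (K : ℝ)⁻¹ / 2) (by positivity)
  rw [nhds_prod_eq (x := (φ 1, ψ x₁))] at hstrict
  obtain ⟨W, hW, hstrict⟩ := mem_prod_self_iff.1 hstrict
  have hW' := inter_mem hW hsmul
  rw [nhds_prod_eq, mem_prod_iff] at hW'
  obtain ⟨B, hB, B', hB', hsub⟩ := hW'
  obtain ⟨δ, hδ, hball⟩ := Metric.mem_nhds_iff.1 hB
  refine ⟨_, inter_mem (extChartAt_source_mem_nhds (I := 𝓡 m) x₁)
    (continuousAt_extChartAt x₁ hB'), (K : ℝ)⁻¹ / 2 / C, by positivity, δ, hδ, ?_⟩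
  rintro x ⟨hxs, hxB⟩ u hu v hv
  have hu' : (u, ψ x) ∈ W ∩ _ := hsub (mk_mem_prod (hball hu) hxB)
  have hv' : (v, ψ x) ∈ W ∩ _ := hsub (mk_mem_prod (hball hv) hxB)
  have h1 := hstrict (mk_mem_prod hu'.1 hv'.1)
  have hval : ∀ w, F (w, ψ x) = ψ (φ.symm w • x) := by
    intro w
    simp only [F, chartAction]
    rw [ψ.left_inv hxs]
  have h2 : edist (ψ (φ.symm u • ψ.symm (ψ x))) (ψ (φ.symm v • ψ.symm (ψ x))) ≤ _ :=
    hlip _ hu'.2 _ hv'.2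
  rw [ψ.left_inv hxs] at h2
  have h3 : (K : ℝ)⁻¹ / 2 * dist u v ≤ dist (ψ (φ.symm u • x)) (ψ (φ.symm v • x)) := by
    simp only [mem_ofPred_eq, Prod.mk_sub_mk, sub_self, hval] at h1
    have h4 := hlow (u - v)
    have h5 : ‖((u - v, 0) : EuclideanSpace ℝ (Fin k) × EuclideanSpace ℝ (Fin m))‖ = ‖u - v‖ := by
      simp [Prod.norm_def]
    rw [h5] at h1
    rw [dist_eq_norm, dist_eq_norm]
    have h6 := norm_sub_norm_le (A (u - v, 0)) (A (u - v, 0) - (ψ (φ.symm u • x) - ψ (φ.symm v • x)))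
    rw [sub_sub_cancel, norm_sub_rev (A (u - v, 0))] at h6
    linarith
  rw [edist_dist] at h2
  have h7 : ENNReal.ofReal ((K : ℝ)⁻¹ / 2 / C * dist u v) * C ≤
      edist (φ.symm u • x) (φ.symm v • x) * C := by
    rw [mul_comm _ (C : ℝ≥0∞), mul_comm _ (C : ℝ≥0∞)]
    refine le_trans ?_ h2
    rw [← ENNReal.ofReal_coe_nnreal, ← ENNReal.ofReal_mul (by positivity)]
    refine ENNReal.ofReal_le_ofReal (le_trans (le_of_eq ?_) h3)
    field_simp
  exact (ENNReal.mul_le_mul_iff_left (by simpa using hC.ne') (by simp)).1 h7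

/-- The orbit maps of a free smooth action on a compact Riemannian manifold are bounded below by a
multiple of the distance in the chart at the identity, uniformly in the base point. -/
theorem exists_le_edist_smul_smul
    {k m : ℕ} {M : Type*} [EMetricSpace M]
    [ChartedSpace (EuclideanSpace ℝ (Fin m)) M] [IsManifold (𝓡 m) ∞ M]
    [RiemannianBundle (fun x : M => TangentSpace (𝓡 m) x)]
    [IsContinuousRiemannianBundle (EuclideanSpace ℝ (Fin m))
      (fun x : M => TangentSpace (𝓡 m) x)]
    [IsRiemannianManifold (𝓡 m) M]
    {G : Type*} [TopologicalSpace G] [ChartedSpace (EuclideanSpace ℝ (Fin k)) G] [Group G]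
    [LieGroup (𝓡 k) ∞ G] [MulAction G M] [ContMDiffSMul (𝓡 k) (𝓡 m) ∞ G M]
    [CompactSpace M]
    (hfree : ∀ (g : G) (x : M), g • x = x → g = 1) :
    ∃ c > (0 : ℝ), ∃ δ > (0 : ℝ),
      Metric.ball (extChartAt (𝓡 k) (1 : G) 1) δ ⊆ (extChartAt (𝓡 k) (1 : G)).target ∧
      ∀ x : M, ∀ u ∈ Metric.ball (extChartAt (𝓡 k) (1 : G) 1) δ,
      ∀ v ∈ Metric.ball (extChartAt (𝓡 k) (1 : G) 1) δ,
        ENNReal.ofReal (c * dist u v) ≤ edist ((extChartAt (𝓡 k) (1 : G)).symm u • x)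
          ((extChartAt (𝓡 k) (1 : G)).symm v • x) := by
  obtain ⟨δ₀, hδ₀, htarget⟩ := Metric.mem_nhds_iff.1 (extChartAt_target_mem_nhds (I := 𝓡 k) (1 : G))
  suffices H : ∃ c > (0 : ℝ), ∃ δ > (0 : ℝ),
      ∀ x ∈ (univ : Set M), ∀ u ∈ Metric.ball (extChartAt (𝓡 k) (1 : G) 1) δ,
      ∀ v ∈ Metric.ball (extChartAt (𝓡 k) (1 : G) 1) δ,
        ENNReal.ofReal (c * dist u v) ≤ edist ((extChartAt (𝓡 k) (1 : G)).symm u • x)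
          ((extChartAt (𝓡 k) (1 : G)).symm v • x) by
    obtain ⟨c, hc, δ, hδ, h⟩ := H
    refine ⟨c, hc, min δ δ₀, lt_min hδ hδ₀,
      (Metric.ball_subset_ball (min_le_right _ _)).trans htarget, fun x u hu v hv => ?_⟩
    exact h x (mem_univ x) u (Metric.ball_subset_ball (min_le_left _ _) hu) v
      (Metric.ball_subset_ball (min_le_left _ _) hv)
  refine isCompact_univ.induction_on (p := fun s : Set M => ∃ c > (0 : ℝ), ∃ δ > (0 : ℝ),
      ∀ x ∈ s, ∀ u ∈ Metric.ball (extChartAt (𝓡 k) (1 : G) 1) δ,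
      ∀ v ∈ Metric.ball (extChartAt (𝓡 k) (1 : G) 1) δ,
        ENNReal.ofReal (c * dist u v) ≤ edist ((extChartAt (𝓡 k) (1 : G)).symm u • x)
          ((extChartAt (𝓡 k) (1 : G)).symm v • x))
    ⟨1, one_pos, 1, one_pos, by simp⟩ ?_ ?_ ?_
  · rintro s t hst ⟨c, hc, δ, hδ, h⟩
    exact ⟨c, hc, δ, hδ, fun x hx => h x (hst hx)⟩
  · rintro s t ⟨c, hc, δ, hδ, h⟩ ⟨c', hc', δ', hδ', h'⟩
    refine ⟨min c c', lt_min hc hc', min δ δ', lt_min hδ hδ', ?_⟩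
    rintro x (hx | hx) u hu v hv
    · refine le_trans ?_ (h x hx u (Metric.ball_subset_ball (min_le_left _ _) hu) v
        (Metric.ball_subset_ball (min_le_left _ _) hv))
      gcongr
      exact min_le_left _ _
    · refine le_trans ?_ (h' x hx u (Metric.ball_subset_ball (min_le_right _ _) hu) v
        (Metric.ball_subset_ball (min_le_right _ _) hv))
      gcongr
      exact min_le_right _ _
  · intro x₀ _
    obtain ⟨V, hV, h⟩ := exists_nhds_le_edist_smul_smul (k := k) (m := m) hfree x₀
    exact ⟨V, mem_nhdsWithin_of_mem_nhds hV, h⟩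

end UniformImmersion

/-! ### The quotient distance. -/

section OrbitDistance

/-- The distance in the quotient by an isometric action, as a function on pairs of points. -/
noncomputable def orbitEDist (G : Type*) {M : Type*} [EMetricSpace M] [Group G] [MulAction G M] (x z : M) :
    ℝ≥0∞ :=
  ⨅ g : G, edist (g • x) z

variable {G : Type*} {M : Type*} [EMetricSpace M] [Group G] [MulAction G M]

lemma orbitEDist_lt_iff {x z : M} {r : ℝ≥0∞} :
    orbitEDist G x z < r ↔ ∃ g : G, edist (g • x) z < r := iInf_lt_iff

lemma isOpen_setOf_orbitEDist_lt (x : M) (r : ℝ≥0∞) : IsOpen {z | orbitEDist G x z < r} := by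
  have : {z | orbitEDist G x z < r} = ⋃ g : G, Metric.eball (g • x) r := by
    ext z
    simp [orbitEDist_lt_iff, Metric.mem_eball, edist_comm]
  rw [this]
  exact isOpen_iUnion fun g => Metric.isOpen_eball

lemma orbitEDist_self (x : M) : orbitEDist G x x = 0 := by
  refine le_antisymm ((iInf_le _ (1 : G)).trans ?_) (zero_le)
  simp

variable [IsIsometricSMul G M]

lemma orbitEDist_comm (x z : M) : orbitEDist G x z = orbitEDist G z x := by
  unfold orbitEDist
  rw [← (Equiv.inv G).iInf_comp]
  refine iInf_congr fun g => ?_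
  rw [Equiv.inv_apply, ← edist_smul_left g, smul_inv_smul, edist_comm]

lemma orbitEDist_triangle (x y z : M) :
    orbitEDist G x z ≤ orbitEDist G x y + orbitEDist G y z := by
  unfold orbitEDist
  refine ENNReal.le_iInf_add_iInf fun g h => (iInf_le _ (h * g)).trans ?_
  rw [mul_smul]
  refine (edist_triangle _ (h • y) _).trans ?_
  rw [edist_smul_left]

/-- An infimum of continuous functions is upper semicontinuous; this gives joint measurability even
when `G` is uncountable. -/
lemma upperSemicontinuous_orbitEDist :
    UpperSemicontinuous fun q : M × M => orbitEDist G q.1 q.2 := by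
  refine upperSemicontinuous_iInf fun g => Continuous.upperSemicontinuous ?_
  exact ((isometry_smul M g).continuous.comp continuous_fst).edist continuous_snd

end OrbitDistance

/-! ### Mass of tubes around orbits. -/

section TubeVolume

/-- If an isometric action has orbits which are uniformly `k`-dimensional from below, and the
balls of radius `r` have mass at least `c r ^ (k + d)`, then the tubes of radius `r` around the
orbits have mass at least `c' r ^ d`. -/
theorem exists_le_measure_tube {k d : ℕ} {M : Type*} [EMetricSpace M]
    [MeasurableSpace M] [BorelSpace M] {G : Type*} [Group G] [MulAction G M]
    (ν : Measure M) [SFinite ν] {c₁ r₀ : ℝ} (hc₁ : 0 < c₁)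
    (hball : ∀ x : M, ∀ r : ℝ, 0 < r → r ≤ r₀ →
      ENNReal.ofReal (c₁ * r ^ (k + d)) ≤ ν (Metric.eball x (ENNReal.ofReal r)))
    {σ : EuclideanSpace ℝ (Fin k) → G} {u₀ : EuclideanSpace ℝ (Fin k)} {c δ : ℝ} (hc : 0 < c)
    (hδ : 0 < δ) (hσ : ∀ x : M, ContinuousOn (fun u => σ u • x) (Metric.ball u₀ δ))
    (hlow : ∀ x : M, ∀ u ∈ Metric.ball u₀ δ, ∀ v ∈ Metric.ball u₀ δ,
      ENNReal.ofReal (c * dist u v) ≤ edist (σ u • x) (σ v • x)) :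
    ∃ c' > (0 : ℝ), ∀ x : M, ∀ r : ℝ, 0 < r → r ≤ r₀ →
      ENNReal.ofReal (c' * r ^ d) ≤ ν {z | orbitEDist G x z < ENNReal.ofReal r} := by
  -- `δ ^ k` is the size of the parameter ball and `(c / 2) ^ k` inverts the bound on the slices
  -- over `z`; the unit ball volume `τ` cancels.
  refine ⟨c₁ * δ ^ k * (c / 2) ^ k, by positivity, fun x r hr hrr => ?_⟩
  set T := {z | orbitEDist G x z < ENNReal.ofReal r}
  -- Incidence set to be measured both ways: its slices over `u` are `r`-balls, while its slices
  -- over `z` have diameter at most `2 * r / c` and are empty outside the tube.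
  set S : Set (EuclideanSpace ℝ (Fin k) × M) := (Metric.ball u₀ δ ×ˢ univ) ∩
    (fun q => edist (σ q.1 • x) q.2) ⁻¹' Iio (ENNReal.ofReal r)
  have hS : IsOpen S := by
    refine ContinuousOn.isOpen_inter_preimage ?_ (Metric.isOpen_ball.prod isOpen_univ) isOpen_Iio
    exact continuous_edist.comp_continuousOn
      (((hσ x).comp continuousOn_fst fun q hq => hq.1).prodMk continuousOn_snd)
  have hT : MeasurableSet T := (isOpen_setOf_orbitEDist_lt x _).measurableSet
  set τ := volume (Metric.ball (0 : EuclideanSpace ℝ (Fin k)) 1)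
  have hτ : 0 < τ.toReal := ENNReal.toReal_pos
    (Metric.measure_ball_pos _ _ one_pos).ne' measure_ball_lt_top.ne
  have hτ' : τ = ENNReal.ofReal τ.toReal :=
    (ENNReal.ofReal_toReal measure_ball_lt_top.ne).symm
  have h1 : ENNReal.ofReal (c₁ * r ^ (k + d)) * (ENNReal.ofReal (δ ^ k) * τ) ≤
      (volume.prod ν) S := by
    rw [Measure.prod_apply hS.measurableSet]
    calc _ = ∫⁻ _ in Metric.ball u₀ δ, ENNReal.ofReal (c₁ * r ^ (k + d)) := by
          rw [setLIntegral_const, Measure.addHaar_ball_of_pos _ _ hδ, finrank_euclideanSpace_fin]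
      _ ≤ ∫⁻ u in Metric.ball u₀ δ, ν (Prod.mk u ⁻¹' S) := by
          refine setLIntegral_mono' measurableSet_ball fun u hu => ?_
          refine (hball (σ u • x) r hr hrr).trans (measure_mono fun z hz => ?_)
          rw [Metric.mem_eball, edist_comm] at hz
          exact ⟨⟨hu, mem_univ _⟩, hz⟩
      _ ≤ _ := setLIntegral_le_lintegral _ _
  have h2 : (volume.prod ν) S ≤ ENNReal.ofReal ((2 * r / c) ^ k) * τ * ν T := by
    rw [Measure.prod_apply_symm hS.measurableSet]
    calc _ ≤ ∫⁻ z, T.indicator (fun _ => ENNReal.ofReal ((2 * r / c) ^ k) * τ) z ∂ν := by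
          refine lintegral_mono fun z => ?_
          rcases ((fun u => (u, z)) ⁻¹' S).eq_empty_or_nonempty with h0 | ⟨u, hu⟩
          · rw [h0, measure_empty]
            exact zero_le
          · have hz : z ∈ T := orbitEDist_lt_iff.2 ⟨σ u, hu.2⟩
            have h4 := Measure.addHaar_closedBall (volume : Measure (EuclideanSpace ℝ (Fin k))) u
              (r := 2 * r / c) (by positivity)
            rw [finrank_euclideanSpace_fin] at h4
            rw [indicator_of_mem hz, ← h4]
            refine measure_mono fun v hv => ?_
            have h3 : ENNReal.ofReal (c * dist v u) ≤ ENNReal.ofReal (r + r) := by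
              rw [ENNReal.ofReal_add hr.le hr.le]
              refine (hlow x v hv.1.1 u hu.1.1).trans ((edist_triangle_right _ _ z).trans ?_)
              exact add_le_add hv.2.le hu.2.le
            rw [ENNReal.ofReal_le_ofReal_iff (by positivity)] at h3
            rw [Metric.mem_closedBall, le_div_iff₀ hc]
            linarith
      _ = _ := by rw [lintegral_indicator_const hT]
  have h3 : ENNReal.ofReal (c₁ * δ ^ k * (c / 2) ^ k * r ^ d) *
      ENNReal.ofReal ((2 * r / c) ^ k * τ.toReal) ≤
      ν T * ENNReal.ofReal ((2 * r / c) ^ k * τ.toReal) := by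
    refine le_trans (le_of_eq ?_) ((h1.trans h2).trans (le_of_eq ?_))
    · rw [hτ', ENNReal.toReal_ofReal hτ.le, ← ENNReal.ofReal_mul (by positivity),
        ← ENNReal.ofReal_mul (by positivity), ← ENNReal.ofReal_mul (by positivity)]
      congr 1
      rw [div_pow, div_pow]
      field_simp
      ring
    · rw [hτ', ENNReal.toReal_ofReal hτ.le, ← ENNReal.ofReal_mul (by positivity), mul_comm]
  refine (ENNReal.mul_le_mul_iff_left ?_ ENNReal.ofReal_ne_top).1 h3
  exact (ENNReal.ofReal_pos.2 (by positivity)).ne'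

end TubeVolume

/-! ### Deterministic quantization of the orbit space. -/

section OrbitCovering

variable {G : Type*} {M : Type*} [EMetricSpace M] [MeasurableSpace M] [BorelSpace M] [Group G]
  [MulAction G M] [IsIsometricSMul G M]

/-- If tubes of radius `r` around orbits have mass at least `a`, then at most `1 / a` tubes of
radius `2 r` cover the space. -/
lemma exists_finset_cover_of_le_measure_tube (ν : Measure M) [IsProbabilityMeasure ν]
    {a r : ℝ} (ha : 0 < a) (hr : 0 < r)
    (htube : ∀ x : M, ENNReal.ofReal a ≤ ν {z | orbitEDist G x z < ENNReal.ofReal r}) :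
    ∃ s : Finset M, (s.card : ℝ) * a ≤ 1 ∧
      ∀ z, ∃ x ∈ s, orbitEDist G x z < ENNReal.ofReal (2 * r) := by
  classical
  let P : Finset M → Prop := fun s =>
    ∀ x ∈ s, ∀ x' ∈ s, x ≠ x' → ENNReal.ofReal (2 * r) ≤ orbitEDist G x x'
  have hcard : ∀ s, P s → (s.card : ℝ) * a ≤ 1 := by
    intro s hs
    have hdisj : (s : Set M).PairwiseDisjoint
        (fun x => {z | orbitEDist G x z < ENNReal.ofReal r}) := by
      intro x hx x' hx' hne
      refine Set.disjoint_left.2 fun z hz hz' => ?_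
      refine absurd (hs x hx x' hx' hne) (not_le.2 ?_)
      refine (orbitEDist_triangle x z x').trans_lt ?_
      rw [orbitEDist_comm z x', two_mul, ENNReal.ofReal_add hr.le hr.le]
      exact ENNReal.add_lt_add hz hz'
    have h1 : (s.card : ℝ≥0∞) * ENNReal.ofReal a ≤ 1 := by
      calc (s.card : ℝ≥0∞) * ENNReal.ofReal a = ∑ _x ∈ s, ENNReal.ofReal a := by simp
        _ ≤ ∑ x ∈ s, ν {z | orbitEDist G x z < ENNReal.ofReal r} :=
          Finset.sum_le_sum fun x _ => htube x
        _ = ν (⋃ x ∈ s, {z | orbitEDist G x z < ENNReal.ofReal r}) :=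
          (measure_biUnion_finset hdisj
            fun x _ => (isOpen_setOf_orbitEDist_lt x _).measurableSet).symm
        _ ≤ 1 := prob_le_one
    rw [← ENNReal.ofReal_natCast, ← ENNReal.ofReal_mul (by positivity)] at h1
    exact ENNReal.ofReal_le_one.1 h1
  -- A separated family of maximal size covers, since an uncovered point could be added to it.
  let A : Set ℕ := {n | ∃ s, P s ∧ s.card = n}
  have hA : BddAbove A := by
    refine ⟨⌊1 / a⌋₊, ?_⟩
    rintro _ ⟨s, hs, rfl⟩
    exact Nat.le_floor ((le_div_iff₀ ha).2 (hcard s hs))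
  obtain ⟨s, hs, hsA⟩ := Nat.sSup_mem (s := A) ⟨0, ∅, by simp [P], rfl⟩ hA
  refine ⟨s, hcard s hs, fun z => ?_⟩
  by_contra! hz
  have hzs : z ∉ s := fun h => by
    have := hz z h
    rw [orbitEDist_self] at this
    exact absurd this (not_le.2 (ENNReal.ofReal_pos.2 (by positivity)))
  have hins : P (insert z s) := by
    intro x hx x' hx' hne
    rw [Finset.mem_insert] at hx hx'
    rcases hx with rfl | hx <;> rcases hx' with rfl | hx'
    · exact absurd rfl hne
    · rw [orbitEDist_comm]
      exact hz x' hx'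
    · exact hz x hx
    · exact hs x hx x' hx' hne
  have := le_csSup hA ⟨_, hins, Finset.card_insert_of_notMem hzs⟩
  omega

/-- Optimal quantization of the orbit space: `n` distinct points whose orbits come within
`O(n ^ (-1/d))` of every point. -/
lemma exists_injective_lintegral_orbitEDist_le [Infinite M] (ν : Measure M)
    [IsProbabilityMeasure ν] {d : ℕ} (hd : 0 < d) {c r₀ : ℝ} (hc : 0 < c) (hr₀ : 0 < r₀)
    (htube : ∀ x : M, ∀ r : ℝ, 0 < r → r ≤ r₀ →
      ENNReal.ofReal (c * r ^ d) ≤ ν {z | orbitEDist G x z < ENNReal.ofReal r}) :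
    ∃ C > (0 : ℝ), ∀ᶠ n : ℕ in atTop, ∃ x : Fin n → M, Function.Injective x ∧
      ∫⁻ z, (⨅ i, orbitEDist G (x i) z) ^ 2 ∂ν ≤
        ENNReal.ofReal (C * (n : ℝ) ^ (-(2 / (d : ℝ)))) := by
  have hd' : (d : ℝ) ≠ 0 := by positivity
  refine ⟨4 * c ^ (-(2 / (d : ℝ))), by positivity, ?_⟩
  have hlim : Tendsto (fun n : ℕ => (c * n : ℝ) ^ (-(1 / (d : ℝ)))) atTop (𝓝 0) :=
    (tendsto_rpow_neg_atTop (by positivity)).comp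
      (tendsto_natCast_atTop_atTop.const_mul_atTop hc)
  filter_upwards [hlim.eventually_le_const hr₀, eventually_gt_atTop 0] with n hn hn0
  have hn0' : (0 : ℝ) < n := by exact_mod_cast hn0
  -- Chosen so that `c * r ^ d = 1 / n`, which allows at most `n` centres.
  set r := (c * n : ℝ) ^ (-(1 / (d : ℝ)))
  have hr : 0 < r := by positivity
  have hrd : c * r ^ d = 1 / n := by
    rw [← Real.rpow_natCast, ← Real.rpow_mul (by positivity), neg_mul, one_div_mul_cancel hd',
      Real.rpow_neg_one]
    field_simp
  have hr2 : r ^ 2 = c ^ (-(2 / (d : ℝ))) * (n : ℝ) ^ (-(2 / (d : ℝ))) := by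
    rw [← Real.mul_rpow hc.le hn0'.le, ← Real.rpow_natCast, ← Real.rpow_mul (by positivity)]
    congr 1
    push_cast
    ring
  obtain ⟨s, hs, hcov⟩ := exists_finset_cover_of_le_measure_tube (G := G) ν
    (a := c * r ^ d) (by positivity) hr (fun x => htube x r hr hn)
  have hsn : s.card ≤ n := by
    rw [hrd, mul_one_div, div_le_one hn0'] at hs
    exact_mod_cast hs
  -- Padding to exactly `n` distinct points only lowers the distance to the orbits.
  obtain ⟨t, hst, ht⟩ := Infinite.exists_superset_card_eq s n hsn
  refine ⟨fun i => (t.equivFinOfCardEq ht).symm i,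
    Subtype.val_injective.comp (Equiv.injective _), ?_⟩
  calc _ ≤ ∫⁻ _, ENNReal.ofReal (2 * r) ^ 2 ∂ν := by
        refine lintegral_mono fun z => ?_
        obtain ⟨x, hx, hxz⟩ := hcov z
        gcongr
        refine (iInf_le _ (t.equivFinOfCardEq ht ⟨x, hst hx⟩)).trans ?_
        simpa using hxz.le
    _ = _ := by
        rw [lintegral_const, measure_univ, mul_one, ← ENNReal.ofReal_pow (by positivity),
          mul_pow, hr2]
        congr 1
        ring

end OrbitCovering

/-! ### Quantization by i.i.d. samples. -/

section RandomQuantization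

/-- The probability that the first `n` terms of an i.i.d. sequence miss a set of mass at least `a`
is at most `exp (-a n)`. -/
lemma measure_iInter_preimage_compl_le_exp {S M : Type*} [MeasurableSpace S] [MeasurableSpace M]
    {μ : Measure S} {ν : Measure M} [IsProbabilityMeasure ν] {X : ℕ → S → M}
    (hX : ∀ i, Measurable (X i)) (hindep : iIndepFun X μ) (hlaw : ∀ i, μ.map (X i) = ν)
    {A : Set M} (hA : MeasurableSet A) {a : ℝ} (ha : ENNReal.ofReal a ≤ ν A) (n : ℕ) :
    μ {s | ∀ i : Fin n, X i s ∉ A} ≤ ENNReal.ofReal (Real.exp (-(a * n))) := by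
  have h1 : {s | ∀ i : Fin n, X i s ∉ A} = ⋂ i ∈ Finset.range n, X i ⁻¹' Aᶜ := by
    ext s
    simp only [mem_ofPred_eq, mem_iInter, Finset.mem_range, mem_preimage, mem_compl_iff]
    exact ⟨fun h i hi => h ⟨i, hi⟩, fun h i => h i i.2⟩
  have h2 : ∀ i, μ (X i ⁻¹' Aᶜ) ≤ ENNReal.ofReal (Real.exp (-a)) := by
    intro i
    rw [← Measure.map_apply (hX i) hA.compl, hlaw, prob_compl_eq_one_sub hA]
    refine (tsub_le_tsub_left ha 1).trans ?_
    rw [← ENNReal.ofReal_one]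
    rcases le_total 0 a with h0 | h0
    · rw [← ENNReal.ofReal_sub _ h0]
      refine ENNReal.ofReal_le_ofReal ?_
      linarith [Real.add_one_le_exp (-a)]
    · refine tsub_le_self.trans (ENNReal.ofReal_le_ofReal ?_)
      exact Real.one_le_exp (by linarith)
  rw [h1, hindep.measure_inter_preimage_eq_mul (Finset.range n) (sets := fun _ => Aᶜ)
    (fun i _ => hA.compl)]
  refine (Finset.prod_le_prod' fun i _ => h2 i).trans (le_of_eq ?_)
  rw [Finset.prod_const, Finset.card_range, ← ENNReal.ofReal_pow (Real.exp_pos _).le,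
    ← Real.exp_nat_mul]
  congr 2
  ring

variable {G : Type*} {M : Type*} [EMetricSpace M] [MeasurableSpace M] [BorelSpace M] [Group G]
  [MulAction G M] [IsIsometricSMul G M] {S : Type*} [MeasurableSpace S] {μ : Measure S}
  {ν : Measure M} [IsProbabilityMeasure ν] {X : ℕ → S → M} {d : ℕ} {c r₀ : ℝ}

/-- With probability tending to one, the orbits of an i.i.d. sample are `r₀`-dense. -/
lemma tendsto_measure_exists_le_iInf_orbitEDist
    (hX : ∀ i, Measurable (X i)) (hindep : iIndepFun X μ) (hlaw : ∀ i, μ.map (X i) = ν)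
    (hc : 0 < c) (hr₀ : 0 < r₀)
    (htube : ∀ x : M, ∀ r : ℝ, 0 < r → r ≤ r₀ →
      ENNReal.ofReal (c * r ^ d) ≤ ν {z | orbitEDist G x z < ENNReal.ofReal r}) :
    Tendsto (fun n : ℕ => μ {s | ∃ z, ENNReal.ofReal r₀ ≤ ⨅ i : Fin n, orbitEDist G (X i s) z})
      atTop (𝓝 0) := by
  -- Tubes of radius `r₀ / 2` about finitely many centres cover; once the sample meets each of them,
  -- the triangle inequality gives `r₀`-density.
  obtain ⟨t, -, ht⟩ := exists_finset_cover_of_le_measure_tube (G := G) ν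
    (a := c * (r₀ / 4) ^ d) (r := r₀ / 4) (by positivity) (by positivity)
    (fun x => htube x _ (by positivity) (by linarith))
  have e2 : 2 * (r₀ / 4) = r₀ / 2 := by ring
  rw [e2] at ht
  set a := c * (r₀ / 2) ^ d
  have ha : 0 < a := by positivity
  have hbound : ∀ n : ℕ, μ {s | ∃ z, ENNReal.ofReal r₀ ≤ ⨅ i : Fin n, orbitEDist G (X i s) z} ≤
      t.card * ENNReal.ofReal (Real.exp (-(a * n))) := by
    intro n
    calc _ ≤ μ (⋃ x ∈ t, {s | ∀ i : Fin n,
          X i s ∉ {z | orbitEDist G x z < ENNReal.ofReal (r₀ / 2)}}) := by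
          refine measure_mono ?_
          rintro s ⟨z, hz⟩
          obtain ⟨x, hx, hxz⟩ := ht z
          refine mem_iUnion₂.2 ⟨x, hx, fun i hi => ?_⟩
          refine absurd (hz.trans (iInf_le _ i)) (not_le.2 ?_)
          refine (orbitEDist_triangle _ x z).trans_lt ?_
          rw [orbitEDist_comm _ x, ← add_halves r₀,
            ENNReal.ofReal_add (by positivity) (by positivity)]
          exact ENNReal.add_lt_add hi hxz
      _ ≤ ∑ x ∈ t, _ := measure_biUnion_finset_le _ _
      _ ≤ ∑ x ∈ t, ENNReal.ofReal (Real.exp (-(a * n))) := Finset.sum_le_sum fun x _ =>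
          measure_iInter_preimage_compl_le_exp hX hindep hlaw
            (isOpen_setOf_orbitEDist_lt x _).measurableSet
            (htube x (r₀ / 2) (by positivity) (by linarith)) n
      _ = _ := by simp
  refine tendsto_of_tendsto_of_tendsto_of_le_of_le tendsto_const_nhds ?_
    (fun n => zero_le) hbound
  have h1 : Tendsto (fun n : ℕ => Real.exp (-(a * n))) atTop (𝓝 0) :=
    Real.tendsto_exp_neg_atTop_nhds_zero.comp (tendsto_natCast_atTop_atTop.const_mul_atTop ha)
  have h2 := ENNReal.Tendsto.const_mul (a := (t.card : ℝ≥0∞)) (ENNReal.tendsto_ofReal h1)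
    (Or.inr (by simp))
  simpa using h2

lemma measurable_iInf_orbitEDist [SecondCountableTopology M] (hX : ∀ i, Measurable (X i)) (n : ℕ) :
    Measurable fun q : M × S => ⨅ i : Fin n, orbitEDist G (X i q.2) q.1 := by
  refine Measurable.iInf fun i => ?_
  exact upperSemicontinuous_orbitEDist.measurable.comp
    (((hX i).comp measurable_snd).prodMk measurable_fst)

/-- The expected squared distance, truncated at `r₀`, of a point to the orbits of an i.i.d. sample
of size `n` is at most a constant times `n ^ (-2/d)`. -/
lemma lintegral_min_iInf_orbitEDist_sq_le [SecondCountableTopology M]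
    (hX : ∀ i, Measurable (X i)) (hindep : iIndepFun X μ) (hlaw : ∀ i, μ.map (X i) = ν)
    (hd : 0 < d) (hc : 0 < c)
    (htube : ∀ x : M, ∀ r : ℝ, 0 < r → r ≤ r₀ →
      ENNReal.ofReal (c * r ^ d) ≤ ν {z | orbitEDist G x z < ENNReal.ofReal r})
    {n : ℕ} (hn : 0 < n) (z : M) :
    ∫⁻ s, (min (⨅ i : Fin n, orbitEDist G (X i s) z) (ENNReal.ofReal r₀)) ^ 2 ∂μ ≤
      ENNReal.ofReal (2 * (c ^ (-(2 / (d : ℝ))) * (1 / d) * Real.Gamma (2 / d)) *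
        (n : ℝ) ^ (-(2 / (d : ℝ)))) := by
  have hd' : (0 : ℝ) < d := by exact_mod_cast hd
  have hn' : (0 : ℝ) < n := by exact_mod_cast hn
  set h : S → ℝ := fun s => (min (⨅ i : Fin n, orbitEDist G (X i s) z) (ENNReal.ofReal r₀)).toReal
  have hfin : ∀ s, min (⨅ i : Fin n, orbitEDist G (X i s) z) (ENNReal.ofReal r₀) ≠ ⊤ := fun s =>
    ((min_le_right _ _).trans_lt ENNReal.ofReal_lt_top).ne
  have hmeas : Measurable h :=
    (((measurable_iInf_orbitEDist (G := G) hX n).comp measurable_prodMk_left).min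
      measurable_const).ennreal_toReal
  have h1 : ∫⁻ s, (min (⨅ i : Fin n, orbitEDist G (X i s) z) (ENNReal.ofReal r₀)) ^ 2 ∂μ =
      ∫⁻ s, ENNReal.ofReal (h s ^ (2 : ℝ)) ∂μ := by
    refine lintegral_congr fun s => ?_
    rw [Real.rpow_two, ENNReal.ofReal_pow ENNReal.toReal_nonneg, ENNReal.ofReal_toReal (hfin s)]
  rw [h1, lintegral_rpow_eq_lintegral_meas_lt_mul μ
    (Eventually.of_forall fun s => ENNReal.toReal_nonneg) hmeas.aemeasurable two_pos]
  -- Below `r₀` the sample must miss the tube about `z`; from `r₀` on the event is empty by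
  -- truncation, so one exponential bound serves all `t`.
  have htail : ∀ t ∈ Ioi (0 : ℝ), μ {s | t < h s} * ENNReal.ofReal (t ^ ((2 : ℝ) - 1)) ≤
      ENNReal.ofReal (t ^ (1 : ℝ) * Real.exp (-(c * n) * t ^ (d : ℝ))) := by
    intro t ht
    rw [mul_comm (t ^ (1 : ℝ)), ENNReal.ofReal_mul (Real.exp_pos _).le]
    norm_num only
    gcongr
    rcases lt_or_ge t r₀ with htr | htr
    · have h2 := measure_iInter_preimage_compl_le_exp hX hindep hlaw
        (isOpen_setOf_orbitEDist_lt (G := G) z _).measurableSet (htube z t ht htr.le) n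
      refine (measure_mono fun s hs i hi => ?_).trans (h2.trans (le_of_eq ?_))
      · have h3 : ENNReal.ofReal t < min (⨅ i : Fin n, orbitEDist G (X i s) z)
            (ENNReal.ofReal r₀) := (ENNReal.ofReal_lt_iff_lt_toReal (le_of_lt ht) (hfin s)).2 hs
        have h4 := (h3.trans_le (min_le_left _ _)).trans_le (iInf_le _ i)
        rw [orbitEDist_comm] at h4
        exact lt_asymm h4 hi
      · rw [Real.rpow_natCast]
        congr 2
        ring
    · have : {s | t < h s} = ∅ := by
        refine eq_empty_of_forall_notMem fun s hs => ?_
        have h3 : ENNReal.ofReal t < min (⨅ i : Fin n, orbitEDist G (X i s) z)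
            (ENNReal.ofReal r₀) := (ENNReal.ofReal_lt_iff_lt_toReal (le_of_lt ht) (hfin s)).2 hs
        exact absurd (h3.trans_le (min_le_right _ _)) (not_lt.2 (ENNReal.ofReal_le_ofReal htr))
      rw [this, measure_empty]
      exact zero_le
  have hint := integrableOn_rpow_mul_exp_neg_mul_rpow (p := (d : ℝ)) (s := 1) (b := c * n)
    (by norm_num) hd' (by positivity)
  calc _ ≤ ENNReal.ofReal 2 * ∫⁻ t in Ioi (0 : ℝ),
        ENNReal.ofReal (t ^ (1 : ℝ) * Real.exp (-(c * n) * t ^ (d : ℝ))) := by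
        gcongr 1
        exact setLIntegral_mono' measurableSet_Ioi htail
    _ = _ := by
        rw [← ofReal_integral_eq_lintegral_ofReal hint, integral_rpow_mul_exp_neg_mul_rpow hd'
          (by norm_num) (by positivity), ← ENNReal.ofReal_mul two_pos.le]
        · congr 1
          rw [show -((1 : ℝ) + 1) / d = -(2 / d) by ring, show ((1 : ℝ) + 1) = 2 by norm_num,
            Real.mul_rpow hc.le hn'.le]
          ring
        · filter_upwards [ae_restrict_mem measurableSet_Ioi] with t ht
          have : (0 : ℝ) < t := ht
          positivity

/-- Random quantization of the orbit space: the mean squared distance to the orbits of an i.i.d.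
sample of size `n` is `O_P(n ^ (-2/d))`. -/
theorem isBigOInProbability_of_le_lintegral_orbitEDist [SecondCountableTopology M]
    [IsProbabilityMeasure μ]
    (hX : ∀ i, Measurable (X i)) (hindep : iIndepFun X μ) (hlaw : ∀ i, μ.map (X i) = ν)
    (hd : 0 < d) (hc : 0 < c) (hr₀ : 0 < r₀)
    (htube : ∀ x : M, ∀ r : ℝ, 0 < r → r ≤ r₀ →
      ENNReal.ofReal (c * r ^ d) ≤ ν {z | orbitEDist G x z < ENNReal.ofReal r})
    {K : ℝ≥0} {R : ℕ → S → ℝ≥0∞}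
    (hR : ∀ n s, R n s ≤ K * ∫⁻ z, (⨅ i : Fin n, orbitEDist G (X i s) z) ^ 2 ∂ν) :
    IsBigOInProbability μ R (fun n => (n : ℝ) ^ (-(2 / (d : ℝ)))) := by
  intro ε hε
  set a : ℕ → ℝ := fun n => (n : ℝ) ^ (-(2 / (d : ℝ)))
  set C₀ := 2 * (c ^ (-(2 / (d : ℝ))) * (1 / d) * Real.Gamma (2 / d))
  have hd' : (0 : ℝ) < d := by exact_mod_cast hd
  have hC₀ : 0 < C₀ := by
    have := Real.Gamma_pos_of_pos (s := 2 / (d : ℝ)) (by positivity)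
    positivity
  -- `ε` may be infinite; the minimum with `1` makes it a positive real, to be split between two bad
  -- events.
  set e := (min ε 1).toReal
  have he' : min ε 1 ≠ ⊤ := ((min_le_right _ _).trans_lt ENNReal.one_lt_top).ne
  have he : 0 < e := ENNReal.toReal_pos (lt_min hε one_pos).ne' he'
  have hee : ENNReal.ofReal e ≤ ε := by
    rw [ENNReal.ofReal_toReal he']
    exact min_le_left _ _
  set J : ℕ → S → ℝ≥0∞ := fun n s =>
    ∫⁻ z, (min (⨅ i : Fin n, orbitEDist G (X i s) z) (ENNReal.ofReal r₀)) ^ 2 ∂ν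
  have hjoint : ∀ n, Measurable fun q : M × S =>
      (min (⨅ i : Fin n, orbitEDist G (X i q.2) q.1) (ENNReal.ofReal r₀)) ^ 2 := fun n =>
    ((measurable_iInf_orbitEDist hX n).min measurable_const).pow_const 2
  have hJmeas : ∀ n, Measurable (J n) := fun n => (hjoint n).lintegral_prod_left'
  have hJ : ∀ n, 0 < n → ∫⁻ s, J n s ∂μ ≤ ENNReal.ofReal (C₀ * a n) := by
    intro n hn
    rw [lintegral_lintegral_swap (f := fun s z =>
      (min (⨅ i : Fin n, orbitEDist G (X i s) z) (ENNReal.ofReal r₀)) ^ 2)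
      ((hjoint n).comp measurable_swap).aemeasurable]
    calc _ ≤ ∫⁻ _, ENNReal.ofReal (C₀ * a n) ∂ν := lintegral_mono fun z =>
          lintegral_min_iInf_orbitEDist_sq_le hX hindep hlaw hd hc htube hn z
      _ = _ := by rw [lintegral_const, measure_univ, mul_one]
  set C₁ := C₀ * (2 / e)
  have hC₁ : 0 < C₁ := by positivity
  refine ⟨K * C₁, ?_⟩
  have hbad := tendsto_measure_exists_le_iInf_orbitEDist hX hindep hlaw hc hr₀ htube
  have hbad' := hbad.eventually_le_const
    (ENNReal.ofReal_pos.2 (show 0 < e / 2 by positivity))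
  filter_upwards [hbad', eventually_gt_atTop 0] with n hn hn0
  have hn' : (0 : ℝ) < n := by exact_mod_cast hn0
  have han : 0 < a n := by positivity
  have hmarkov : μ {s | ENNReal.ofReal (C₁ * a n) ≤ J n s} ≤ ENNReal.ofReal (e / 2) := by
    refine (meas_ge_le_lintegral_div (hJmeas n).aemeasurable
      (ENNReal.ofReal_pos.2 (by positivity)).ne' ENNReal.ofReal_ne_top).trans ?_
    refine (ENNReal.div_le_div_right (hJ n hn0) _).trans (le_of_eq ?_)
    rw [← ENNReal.ofReal_div_of_pos (by positivity)]
    congr 1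
    simp only [C₁]
    field_simp
  -- If the sampled orbits are `r₀`-dense, the truncated integral `J` is the full one.
  have hsub : {s | ENNReal.ofReal (K * C₁ * a n) < R n s} ⊆
      {s | ∃ z, ENNReal.ofReal r₀ ≤ ⨅ i : Fin n, orbitEDist G (X i s) z} ∪
      {s | ENNReal.ofReal (C₁ * a n) ≤ J n s} := by
    intro s hs
    by_contra hcon
    rw [mem_union, not_or] at hcon
    obtain ⟨h1, h2⟩ := hcon
    simp only [mem_ofPred_eq, not_exists, not_le] at h1 h2
    refine absurd hs (not_lt.2 ((hR n s).trans ?_))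
    rw [mul_assoc, ENNReal.ofReal_mul (NNReal.coe_nonneg K), ENNReal.ofReal_coe_nnreal]
    gcongr
    refine le_trans (lintegral_mono fun z => ?_) h2.le
    rw [min_eq_left (h1 z).le]
  calc _ ≤ _ := measure_mono hsub
    _ ≤ _ := measure_union_le _ _
    _ ≤ ENNReal.ofReal (e / 2) + ENNReal.ofReal (e / 2) := add_le_add hn hmarkov
    _ = ENNReal.ofReal e := by
      rw [← ENNReal.ofReal_add (by positivity) (by positivity), add_halves]
    _ ≤ ε := hee

end RandomQuantization

/-! ### From interpolation to orbit distances. -/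

section Interpolation

variable {G M Y : Type*} [EMetricSpace M] [EMetricSpace Y] [Group G] [MulAction G M]
  [MulAction G Y] {y : M → Y} {L : ℝ≥0} {f : ∀ n : ℕ, (Fin n → M × Y) → M → Y}
  {predSpace : ∀ n : ℕ, (Fin n → M × Y) → Set (M × Y)}

namespace IsEquivariantInterpolatingModel

/-- Augmented data belong to the prediction space, hence to the graph of the trained function. -/
lemma apply_smul_eq (hf : IsEquivariantInterpolatingModel G y L f predSpace) {n : ℕ}
    (x : Fin n → M) (g : G) (i : Fin n) :
    f n (fun i => (x i, y (x i))) (g • x i) = g • y (x i) := by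
  have hD : ∀ i, (x i, y (x i)) ∈ graphSet y := fun i => rfl
  exact (hf.subset_graph n _ hD (hf.augmentation_subset n _ hD ⟨g, i, rfl⟩)).symm

/-- A target function that can be interpolated on all datasets is Lipschitz. -/
lemma target_lipschitzWith (hf : IsEquivariantInterpolatingModel G y L f predSpace) :
    LipschitzWith L y := by
  intro a b
  have hD : ∀ i, (![a, b] i, y (![a, b] i)) ∈ graphSet y := fun i => rfl
  have ha := hf.apply_smul_eq ![a, b] (1 : G) 0
  have hb := hf.apply_smul_eq ![a, b] (1 : G) 1
  simp only [one_smul] at ha hb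
  have := hf.lipschitz 2 _ hD a b
  simpa using ha ▸ hb ▸ this

/-- A target function that can be interpolated on all datasets is equivariant. -/
lemma target_smul (hf : IsEquivariantInterpolatingModel G y L f predSpace) (g : G) (a : M) :
    y (g • a) = g • y a := by
  -- The prediction at `g • a` is read twice: from the datum at `a` moved by `g`, and from the datum
  -- at `g • a`.
  have ha := hf.apply_smul_eq ![a, g • a] g 0
  have hb := hf.apply_smul_eq ![a, g • a] (1 : G) 1
  simp only [one_smul] at hb
  exact hb.symm.trans ha

/-- Compare with the augmented point over `g • x i`: by equivariance its label is `y (g • x i)`, so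
the Lipschitz bound on `y` controls the second term of the cost. -/
lemma representationGap_le [MeasurableSpace M]
    (hf : IsEquivariantInterpolatingModel G y L f predSpace) (ν : Measure M) {n : ℕ}
    (x : Fin n → M) :
    representationGap ν y (predSpace n (fun i => (x i, y (x i)))) ≤
      ((1 + L ^ 2 : ℝ≥0) : ℝ≥0∞) * ∫⁻ z, (⨅ i, orbitEDist G (x i) z) ^ 2 ∂ν := by
  rw [← lintegral_const_mul' _ _ ENNReal.coe_ne_top]
  refine lintegral_mono fun z => ?_
  have hcont : Continuous fun t : ℝ≥0∞ => ((1 + L ^ 2 : ℝ≥0) : ℝ≥0∞) * t ^ 2 :=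
    (ENNReal.continuous_const_mul ENNReal.coe_ne_top).comp (ENNReal.continuous_pow 2)
  have hmono : Monotone fun t : ℝ≥0∞ => ((1 + L ^ 2 : ℝ≥0) : ℝ≥0∞) * t ^ 2 := by
    intro s t hst
    dsimp only
    gcongr
  -- Needed when the index set is empty (`n = 0`), where the infimum is `⊤`.
  have htop : ((1 + L ^ 2 : ℝ≥0) : ℝ≥0∞) * ⊤ ^ 2 = ⊤ := by
    rw [ENNReal.top_pow two_ne_zero, ENNReal.mul_top]
    exact ENNReal.coe_ne_zero.2 (by positivity)
  have h1 := hmono.map_iInf_of_continuousAt (f := fun t => ((1 + L ^ 2 : ℝ≥0) : ℝ≥0∞) * t ^ 2)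
    (g := fun q : Fin n × G => edist (q.2 • x q.1) z) hcont.continuousAt htop
  rw [iInf_prod] at h1
  refine le_of_le_of_eq (le_iInf fun q => ?_) h1.symm
  have hD : ∀ i, (x i, y (x i)) ∈ graphSet y := fun i => rfl
  refine (iInf₂_le (q.2 • x q.1, q.2 • y (x q.1))
    (hf.augmentation_subset n _ hD ⟨q.2, q.1, rfl⟩)).trans ?_
  have h2 := hf.target_lipschitzWith z (q.2 • x q.1)
  simp only [separableCost, Function.comp_apply, ← hf.target_smul]
  rw [edist_comm (q.2 • x q.1) z]
  push_cast
  rw [add_mul, one_mul, ← mul_pow]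
  gcongr

end IsEquivariantInterpolatingModel

end Interpolation

/-! ### Properties of the input law. -/

section DataLaw

variable {m : ℕ} {M : Type*} [EMetricSpace M] [MeasurableSpace M] [BorelSpace M] {p : M → ℝ}

/-- In positive dimension Hausdorff measure has no atoms, so a finite space would have total mass
zero. This guarantees datasets of `n` distinct points for every `n`. -/
lemma infinite_of_isProbabilityMeasure_dataLaw (hm : 0 < m)
    (hp : IsProbabilityMeasure (dataLaw m p)) : Infinite M := by
  by_contra hfin
  rw [not_infinite_iff_finite] at hfin
  have := Measure.nullSingletonClass_hausdorff M (d := m) (by exact_mod_cast hm)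
  have h1 : riemannianVolume M m univ = 0 := by
    rw [riemannianVolume, Measure.euclideanHausdorffMeasure_def, Measure.smul_apply,
      (finite_univ (α := M)).countable.measure_zero, smul_zero]
  have h2 := withDensity_absolutelyContinuous (riemannianVolume M m)
    (fun x => ENNReal.ofReal (p x)) h1
  have h3 : dataLaw m p univ = 1 := measure_univ
  exact one_ne_zero (h3.symm.trans h2)

/-- The density attains a positive minimum by compactness, so lower volume bounds pass to the law.
-/
lemma exists_mul_riemannianVolume_le_dataLaw [CompactSpace M] (hp_cont : Continuous p)
    (hp_pos : ∀ x, 0 < p x) :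
    ∃ q > (0 : ℝ), ∀ s : Set M, ENNReal.ofReal q * riemannianVolume M m s ≤ dataLaw m p s := by
  obtain ⟨q, hq, hqp⟩ : ∃ q > (0 : ℝ), ∀ x, q ≤ p x := by
    rcases isEmpty_or_nonempty M with h | h
    · exact ⟨1, one_pos, fun x => h.elim x⟩
    · obtain ⟨x, -, hx⟩ := isCompact_univ.exists_isMinOn univ_nonempty hp_cont.continuousOn
      exact ⟨p x, hp_pos x, fun z => hx (mem_univ z)⟩
  refine ⟨q, hq, fun s => ?_⟩
  have h1 : (riemannianVolume M m).withDensity (fun _ => ENNReal.ofReal q) ≤ dataLaw m p :=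
    withDensity_mono (Eventually.of_forall fun x => ENNReal.ofReal_le_ofReal (hqp x))
  rw [withDensity_const] at h1
  simpa using h1 s

end DataLaw

/-! ### Assembly of the two rates. -/

theorem theorem4 {m k d : ℕ} (hd : 0 < d) (hdim : m = k + d)
    -- the input manifold: a compact `m`-dimensional Riemannian manifold without boundary
    {M : Type*} [EMetricSpace M] [CompactSpace M] [MeasurableSpace M] [BorelSpace M]
    [ChartedSpace (EuclideanSpace ℝ (Fin m)) M] [IsManifold (𝓡 m) ∞ M]
    [RiemannianBundle (fun x : M => TangentSpace (𝓡 m) x)]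
    [IsContMDiffRiemannianBundle (𝓡 m) ∞ (EuclideanSpace ℝ (Fin m))
      (fun x : M => TangentSpace (𝓡 m) x)]
    [IsRiemannianManifold (𝓡 m) M]
    -- the `k`-dimensional Lie group of isometries, acting smoothly, freely and properly
    {G : Type*} [TopologicalSpace G] [ChartedSpace (EuclideanSpace ℝ (Fin k)) G] [Group G]
    [LieGroup (𝓡 k) ∞ G] [MulAction G M] [IsIsometricSMul G M]
    [ContMDiffSMul (𝓡 k) (𝓡 m) ∞ G M] [ProperSMul G M]
    (hfree : ∀ (g : G) (x : M), g • x = x → g = 1)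
    -- all orbits have the same Riemannian volume
    (hvol : ∃ v : ℝ≥0∞, ∀ x : M, riemannianVolume M k (MulAction.orbit G x) = v)
    -- the target space, the target function, and the density of the inputs
    {Y : Type*} [EMetricSpace Y] [MulAction G Y] (y : M → Y)
    (p : M → ℝ) (hp_cont : Continuous p) (hp_pos : ∀ x, 0 < p x)
    (hp_prob : IsProbabilityMeasure (dataLaw m p))
    -- the trained model and its prediction space, as functions of the dataset
    (L : ℝ≥0) (f : ∀ n : ℕ, (Fin n → M × Y) → M → Y)
    (predSpace : ∀ n : ℕ, (Fin n → M × Y) → Set (M × Y))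
    (hf : IsEquivariantInterpolatingModel G y L f predSpace) :
    -- random datasets: the first `n` terms of an i.i.d. sequence of inputs with their targets
    (∀ {S : Type*} [MeasurableSpace S] (μ : Measure S) [IsProbabilityMeasure μ]
        (X : ℕ → S → M), (∀ i, Measurable (X i)) → iIndepFun X μ →
        (∀ i, μ.map (X i) = dataLaw m p) →
        IsBigOInProbability μ
          (fun n s => representationGap (dataLaw m p) y
            (predSpace n (fun i => (X i s, y (X i s)))))
          (fun n => (n : ℝ) ^ (-(2 / (d : ℝ))))) ∧
    -- optimal datasets
    (∃ C : ℝ, ∀ᶠ n : ℕ in atTop,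
      optimalGap (dataLaw m p) y predSpace n ≤ ENNReal.ofReal (C * (n : ℝ) ^ (-(2 / (d : ℝ))))) := by

  have : IsManifold (𝓡 m) 1 M := IsManifold.of_le (n := ∞) (by norm_cast)
  have : IsContinuousRiemannianBundle (EuclideanSpace ℝ (Fin m))
      (fun x : M => TangentSpace (𝓡 m) x) := by
    obtain ⟨g, hg, hinner⟩ := IsContMDiffRiemannianBundle.exists_contMDiff (IB := 𝓡 m) (n := ∞)
      (F := EuclideanSpace ℝ (Fin m)) (E := fun x : M => TangentSpace (𝓡 m) x)
    exact ⟨g, hg.continuous, hinner⟩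
  have : SecondCountableTopology M := EMetric.secondCountable_of_sigmaCompact M
  have hcs : ContinuousSMul G M := ContMDiffSMul.continuousSMul (I := 𝓡 k) (I' := 𝓡 m) ∞
  have : Infinite M := infinite_of_isProbabilityMeasure_dataLaw (by omega) hp_prob
  obtain ⟨q, hq, hqν⟩ := exists_mul_riemannianVolume_le_dataLaw (m := m) hp_cont hp_pos
  obtain ⟨c₁, hc₁, r₀, hr₀, hball⟩ := exists_le_riemannianVolume_eball (m := m) (M := M)
  obtain ⟨c, hc, δ, hδ, htarget, hlow⟩ :=
    exists_le_edist_smul_smul (k := k) (m := m) (G := G) (M := M) hfree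
  -- The group parameters are the coordinates of the chart at the identity, and `m = k + d` turns
  -- the ball exponent into the one required.
  obtain ⟨c', hc', htube⟩ := exists_le_measure_tube (k := k) (d := d) (G := G) (dataLaw m p)
    (c₁ := q * c₁) (r₀ := r₀) (by positivity)
    (fun x r hr hrr => by
      refine le_trans ?_ (hqν _)
      rw [mul_assoc, ENNReal.ofReal_mul hq.le, ← hdim]
      gcongr
      exact hball x r hr hrr)
    hc hδ
    (fun x => (((continuousOn_extChartAt_symm (I := 𝓡 k) (1 : G)).mono htarget).smul
      continuousOn_const)) hlow
  constructor
  · intro S _ μ _ X hX hindep hlaw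
    exact isBigOInProbability_of_le_lintegral_orbitEDist hX hindep hlaw hd hc' hr₀ htube
      (fun n s => hf.representationGap_le (dataLaw m p) fun i => X i s)
  · obtain ⟨C, hC, hx⟩ := exists_injective_lintegral_orbitEDist_le (G := G) (dataLaw m p) hd hc' hr₀
      htube
    refine ⟨(1 + L ^ 2 : ℝ≥0) * C, hx.mono fun n ⟨x, hinj, hxn⟩ => ?_⟩
    have hopt : optimalGap (dataLaw m p) y predSpace n ≤
        representationGap (dataLaw m p) y (predSpace n fun i => (x i, y (x i))) := by
      unfold optimalGap
      refine iInf_le_of_le (fun i => (x i, y (x i))) (iInf_le_of_le (fun i => rfl) ?_)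
      exact iInf_le _ fun i j hij => hinj (congrArg Prod.fst hij)
    refine hopt.trans ?_
    refine (hf.representationGap_le (dataLaw m p) x).trans ?_
    rw [mul_assoc, ENNReal.ofReal_mul (NNReal.coe_nonneg _), ENNReal.ofReal_coe_nnreal]
    gcongr
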